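/- **Setting.** Let $n\ge 1$, $d\ge 0$, and let $\ell_1,\dots,\ell_n:\mathbb{R}^d\to\mathbb{R}$ be convex, $G$-Lipschitz, and $L$-smooth (differentiable with $L$-Lipschitz gradient) with respect to the Euclidean norm, where $G,L\ge 0$. Let $\mu,\nu,\alpha_n>0$, and let $\sigma=(\sigma_1,\dots,\sigma_n)$ satisfy $0\le\sigma_1\le\dots\le\sigma_n$ and $\sum_i\sigma_i=1$. Let $\mathcal{P}(\sigma)\subset\mathbb{R}^n$ be the convex hull of all permutations of $\sigma$. Let $f:[0,\infty)\to\mathbb{R}$ be convex with $f(1)=0$ and $f(0)=\lim_{x\to0^+}f(x)$, and let $f$ be $\alpha_n$-strongly convex on $[0,n]$. Put $D_f(q\Vert \mathbf 1_n/n)=\frac1n\sum_{i=1}^n f(nq_i)$. For $l\in\mathbb{R}^n$ let $$q^{\mathrm{opt}}(l)=\operatorname*{arg\,max}_{q\in\mathcal{P}(\sigma)}\ \bigl\{q^\top l-\nu D_f(q\Vert\mathbf 1_n/n)\bigr\},\qquad F_\sigma(w)=\max_{q\in\mathcal{P}(\sigma)}\bigl\{q^\top\ell(w)-\nu D_f(q\Vert\mathbf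 1_n/n)\bigr\}+\frac{\mu}{2}\|w\|_2^2 .$$ Write $r_i(w)=\ell_i(w)+\frac\mu2\|w\|_2^2$, $\kappa=1+L/\mu$, $\kappa_\sigma=n\sigma_n$, $\bar\nu=n\alpha_n\nu$ and $\delta=nG^2/(\mu\bar\nu)$. **Algorithm (Prospect, step size $\eta>0$, initial point $w_0$).** Set $\zeta_i^{(0)}=z_i^{(0)}=w_0$ for all $i$ and $\rho^{(0)}=q^{\mathrm{opt}}(\ell(w_0))$. For $t=0,1,2,\dots$: let $q^{(t)}=q^{\mathrm{opt}}\bigl((\ell_k(\zeta_k^{(t)}))_{k=1}^n\bigr)$, draw $i_t,j_t$ uniformly from $\{1,\dots,n\}$, independently of each other and of the past, and set $$w_{t+1}=w_t-\eta\Bigl(nq^{(t)}_{i_t}\nabla r_{i_t}(w_t)-n\rho^{(t)}_{i_t}\nabla r_{i_t}(z^{(t)}_{i_t})+\sum_{k=1}^n\rho_k^{(t)}\nabla r_k(z_k^{(t)})\Bigr),$$ $\zeta^{(t+1)}_{j_t}=w_t$, $z^{(t+1)}_{i_t}=w_t$, $\rho^{(t+1)}_{i_t}=q^{(t)}_{i_t}$,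 all other entries of $\zeta,z,\rho$ being unchanged. **Theorem.** The maximizer $q^{\mathrm{opt}}(l)$ exists and is unique for every $l\in\mathbb{R}^n$, $F_\sigma$ has a unique minimizer $w^\star$, and the following hold. 1. (Any shift cost.) There is $\eta_0>0$ such that for every $\eta\in(0,\eta_0]$ there are $C,\tau>0$ with $\mathbb{E}\|w_t-w^\star\|_2^2\le C\exp(-t/\tau)\|w_0-w^\star\|_2^2$ for all $w_0\in\mathbb{R}^d$ and all $t\ge0$. 2. (Large shift cost.) If $\nu\ge 8G^2/(\mu\alpha_n)$ and $\eta=\frac{1}{12\mu(1+\kappa)\kappa_\sigma}$, then for all $w_0$ and $t\ge0$ $$\mathbb{E}\|w_t-w^\star\|_2^2\le(1+\sigma_n^{-1}+\sigma_n^{-2})\exp(-t/\tau)\|w_0-w^\star\|_2^2,\qquad \tau=2\max\{n,\,24\kappa_\sigma(\kappa+1)\}.$$ 3. (Small shift cost.) If $n\ge2$, $\nu\le 8G^2/(\mu\alpha_n)$ and $$\eta=\frac1{16n\mu}\min\Bigl\{\frac1{6[8\delta+(\kappa+1)\kappa_\sigma]},\ \frac1{4\delta^2\max\{2n\kappa^2,\delta\}}\Bigr\},$$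 then for all $w_0$ and $t\ge0$ $$\mathbb{E}\|w_t-w^\star\|_2^2\le\Bigl(5+16\delta+\frac{6\kappa^2}{\sigma_n}\Bigr)\exp(-t/\tau)\|w_0-w^\star\|_2^2,$$ $$\tau=32n\max\Bigl\{6[8\delta+(\kappa+1)\kappa_\sigma],\ 4\delta^2\max\{2n\kappa^2,\delta\},\ \tfrac1{16}\Bigr\}.$$ -/

import Mathlib

open MeasureTheory ProbabilityTheory
open scoped NNReal Topology

/-- Generator of an `f`-divergence: a convex function on `[0, ∞)` that vanishes at `1` and whose
value at `0` is its limit from the right. (Values on the negative axis are irrelevant.) -/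
structure IsDivergenceGenerator (f : ℝ → ℝ) : Prop where
  convex : ConvexOn ℝ (Set.Ici 0) f
  map_one : f 1 = 0
  tendsto_zero : Filter.Tendsto f (𝓝[>] 0) (𝓝 (f 0))

/-- A spectrum: nonnegative nondecreasing weights that sum to one. -/
structure IsSpectrum {n : ℕ} (σ : Fin n → ℝ) : Prop where
  nonneg : ∀ i, 0 ≤ σ i
  mono : Monotone σ
  sum_eq_one : ∑ i, σ i = 1

/-- The uncertainty set `P(σ)`: the convex hull of all permutations of `σ`. -/
def permutahedron {n : ℕ} (σ : Fin n → ℝ) : Set (Fin n → ℝ) :=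
  convexHull ℝ (Set.range fun π : Equiv.Perm (Fin n) => σ ∘ π)

/-- The `f`-divergence `D_f(q ‖ 𝟏/n)` from `q` to the uniform distribution on `n` atoms. -/
noncomputable def fDivUniform {n : ℕ} (f : ℝ → ℝ) (q : Fin n → ℝ) : ℝ :=
  (1 / (n : ℝ)) * ∑ i, f (n * q i)

/-- The penalized expected loss `qᵀ l - ν D_f(q ‖ 𝟏/n)`. -/
noncomputable def penalizedLoss {n : ℕ} (f : ℝ → ℝ) (ν : ℝ) (l q : Fin n → ℝ) : ℝ :=
  ∑ i, q i * l i - ν * fDivUniform f q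

/-- The spectral risk with shift cost `ν`:
`R_σ(l) = max_{q ∈ P(σ)} (qᵀ l - ν D_f(q ‖ 𝟏/n))`. -/
noncomputable def spectralRisk {n : ℕ} (σ : Fin n → ℝ) (f : ℝ → ℝ) (ν : ℝ) (l : Fin n → ℝ) : ℝ :=
  sSup (penalizedLoss f ν l '' permutahedron σ)

/-- `q` maximizes the penalized expected loss over `P(σ)`. -/
def IsDualMaximizer {n : ℕ} (σ : Fin n → ℝ) (f : ℝ → ℝ) (ν : ℝ) (l q : Fin n → ℝ) : Prop :=
  q ∈ permutahedron σ ∧ IsMaxOn (penalizedLoss f ν l) (permutahedron σ) q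

/-- `argmax_{q ∈ P(σ)} (qᵀ l - ν D_f(q ‖ 𝟏/n))`, a maximizer whenever there is one. -/
noncomputable def qOpt {n : ℕ} (σ : Fin n → ℝ) (f : ℝ → ℝ) (ν : ℝ) (l : Fin n → ℝ) : Fin n → ℝ :=
  Classical.epsilon (IsDualMaximizer σ f ν l)

/-- The regularized objective `F_σ(w) = R_σ(ℓ(w)) + (μ/2) ‖w‖²`. -/
noncomputable def objective {n d : ℕ} (ℓ : Fin n → EuclideanSpace ℝ (Fin d) → ℝ)
    (σ : Fin n → ℝ) (f : ℝ → ℝ) (ν μ : ℝ) (w : EuclideanSpace ℝ (Fin d)) : ℝ :=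
  spectralRisk σ f ν (fun i => ℓ i w) + μ / 2 * ‖w‖ ^ 2

/-- Gradient of the regularized loss `r_i(w) = ℓ_i(w) + (μ/2) ‖w‖²`. -/
noncomputable def gradReg {n d : ℕ} (ℓ : Fin n → EuclideanSpace ℝ (Fin d) → ℝ) (μ : ℝ)
    (i : Fin n) (w : EuclideanSpace ℝ (Fin d)) : EuclideanSpace ℝ (Fin d) :=
  gradient (fun u => ℓ i u + μ / 2 * ‖u‖ ^ 2) w

/-- State of Prospect: the iterate `w`, the points `ζ i` at which the loss table was filled, the
points `z i` at which the gradient table was filled, and the weight table `ρ`. The tables themselves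
are `l i = ℓ i (ζ i)` and `g i = ∇ r i (z i)`. -/
structure ProspectState (n d : ℕ) where
  w : EuclideanSpace ℝ (Fin d)
  ζ : Fin n → EuclideanSpace ℝ (Fin d)
  z : Fin n → EuclideanSpace ℝ (Fin d)
  ρ : Fin n → ℝ

/-- The weights `q` computed from the loss table. -/
noncomputable def ProspectState.q {n d : ℕ} (s : ProspectState n d)
    (ℓ : Fin n → EuclideanSpace ℝ (Fin d) → ℝ) (σ : Fin n → ℝ) (f : ℝ → ℝ) (ν : ℝ) : Fin n → ℝ :=
  qOpt σ f ν (fun k => ℓ k (s.ζ k))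

/-- The update direction `v = n q_i ∇r_i(w) - (n ρ_i g_i - ∑ k, ρ_k g_k)`. -/
noncomputable def ProspectState.v {n d : ℕ} (s : ProspectState n d)
    (ℓ : Fin n → EuclideanSpace ℝ (Fin d) → ℝ) (σ : Fin n → ℝ) (f : ℝ → ℝ) (ν μ : ℝ)
    (i : Fin n) : EuclideanSpace ℝ (Fin d) :=
  (n * s.q ℓ σ f ν i) • gradReg ℓ μ i s.w
    - ((n * s.ρ i) • gradReg ℓ μ i (s.z i) - ∑ k, s.ρ k • gradReg ℓ μ k (s.z k))

/-- Initialization: all tables are filled at `w₀`. -/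
noncomputable def prospectInit {n d : ℕ} (ℓ : Fin n → EuclideanSpace ℝ (Fin d) → ℝ)
    (σ : Fin n → ℝ) (f : ℝ → ℝ) (ν : ℝ) (w₀ : EuclideanSpace ℝ (Fin d)) : ProspectState n d where
  w := w₀
  ζ := fun _ => w₀
  z := fun _ => w₀
  ρ := qOpt σ f ν (fun k => ℓ k w₀)

/-- One iteration with step size `η`: `i` drives the iterate and the gradient and weight tables,
`j` drives the loss table. -/
noncomputable def prospectStep {n d : ℕ} (ℓ : Fin n → EuclideanSpace ℝ (Fin d) → ℝ)
    (σ : Fin n → ℝ) (f : ℝ → ℝ) (ν μ η : ℝ) (i j : Fin n) (s : ProspectState n d) :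
    ProspectState n d where
  w := s.w - η • s.v ℓ σ f ν μ i
  ζ := Function.update s.ζ j s.w
  z := Function.update s.z i s.w
  ρ := Function.update s.ρ i (s.q ℓ σ f ν i)

/-- The state of Prospect after `t` iterations driven by the index sequences `i` and `j`. -/
noncomputable def prospectState {n d : ℕ} (ℓ : Fin n → EuclideanSpace ℝ (Fin d) → ℝ)
    (σ : Fin n → ℝ) (f : ℝ → ℝ) (ν μ η : ℝ) (w₀ : EuclideanSpace ℝ (Fin d)) (i j : ℕ → Fin n) :
    ℕ → ProspectState n d
  | 0 => prospectInit ℓ σ f ν w₀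
  | t + 1 => prospectStep ℓ σ f ν μ η (i t) (j t) (prospectState ℓ σ f ν μ η w₀ i j t)

/-- `i t`, `j t` (for `t = 0, 1, …`) are independent and uniform on the `n` indices: the pairs are
independent over `t`, and each pair is uniform on the `n²` pairs of indices. -/
structure IsUniformSampling {n : ℕ} [NeZero n] {Ω : Type*} [MeasurableSpace Ω] (P : Measure Ω)
    (i j : ℕ → Ω → Fin n) : Prop where
  measurable_fst : ∀ t, Measurable (i t)
  measurable_snd : ∀ t, Measurable (j t)
  indep : iIndepFun (fun t ω => (i t ω, j t ω)) P
  law : ∀ t, P.map (fun ω => (i t ω, j t ω)) = (PMF.uniformOfFintype (Fin n × Fin n)).toMeasure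

/-- `𝔼 ‖w_t - w⋆‖²` for the iterates of Prospect driven by the random indices `i`, `j`. -/
noncomputable def expectedSqDist {n d : ℕ} {Ω : Type*} [MeasurableSpace Ω] (P : Measure Ω)
    (i j : ℕ → Ω → Fin n) (ℓ : Fin n → EuclideanSpace ℝ (Fin d) → ℝ)
    (σ : Fin n → ℝ) (f : ℝ → ℝ) (ν μ η : ℝ) (w₀ wStar : EuclideanSpace ℝ (Fin d)) (t : ℕ) : ℝ :=
  ∫ ω, ‖(prospectState ℓ σ f ν μ η w₀ (fun s => i s ω) (fun s => j s ω) t).w - wStar‖ ^ 2 ∂P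

/-! The problem is a saddle point: the dual weights `p = qOpt (ℓ u)` at the minimizer `u` satisfy `∑
p_k ∇r_k(u) = 0` (`sum_qOpt_smul_gradient_eq_zero`), and strong concavity makes the map from losses
to weights strongly monotone with modulus `nαν` (`IsDualMaximizer.monotone`). Convexity of the
losses then bounds the inner product of the mean update direction with `w - u` below by `μ‖w - u‖²`,
plus a `q`-weighted sum of Bregman divergences, plus a coupling term `∑ (q_k - p_k)(ℓ_k(w) -
ℓ_k(u))` (`le_inner_sum_smul_gradReg`).

Were `q` computed from the losses at `w`, the coupling would be nonnegative. It is computed from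
stale points `ζ_k`, and there are two ways to pay for that. For any shift cost, split `ℓ_k(w) -
ℓ_k(u)` at `ℓ_k(ζ_k)`: the first piece gives `N = nαν ∑ (q_k - p_k)²` by monotonicity, and Young's
inequality bounds the second by `N/2` plus a multiple of the staleness `∑ ‖w - ζ_k‖²`. For a large
shift cost, `δ ≤ 1/8`, Young's inequality applied to the whole coupling suffices, and the Lipschitz
bound on the weights controls `N` by `∑ ‖ζ_k - u‖²`.

The noise is handled as in SAGA. The direction is unbiased for the weights `q`, and its second
moment is at most twice the squared error of the gradient table plus twice that of the current
weighted gradients (`sum_sq_norm_prospect_v_le`). Cocoercivity bounds the current error by the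
Bregman terms, `‖w - u‖²` and `N` (`gradTableError_le_bregman`), so a small step absorbs it.

Adding the table errors to `‖w - u‖²` gives a Lyapunov function whose average contracts
(`contraction_of_small_step`, `contraction_of_large_shift_cost`). Independence of the fresh indices
lets the contraction be iterated (`expectedSqDist_le_of_lyapunov`). The first contraction yields
claims 1 and 3, the second claim 2. -/

/-! ### Gradient inequalities for smooth convex functions. -/

section SmoothConvex

variable {E : Type*} [NormedAddCommGroup E] [InnerProductSpace ℝ E] [CompleteSpace E] {g : E → ℝ}

theorem hasDerivAt_along_line (hd : Differentiable ℝ g) (x u : E) (t : ℝ) :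
    HasDerivAt (fun s : ℝ => g (x + s • u)) (inner ℝ (gradient g (x + t • u)) u) t := by
  have h1 : HasDerivAt (fun s : ℝ => x + s • u) u t := by
    simpa using ((hasDerivAt_id t).smul_const u).const_add x
  have h2 := (hd (x + t • u)).hasFDerivAt.comp_hasDerivAt t h1
  rw [inner_gradient_left]
  exact h2

theorem ConvexOn.add_inner_gradient_le (hc : ConvexOn ℝ Set.univ g) (hd : Differentiable ℝ g)
    (x y : E) : g x + inner ℝ (gradient g x) (y - x) ≤ g y := by
  have h0 := hasDerivAt_along_line hd x (y - x) 0
  have hconv : ConvexOn ℝ Set.univ (fun s : ℝ => g (x + s • (y - x))) := by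
    refine ⟨convex_univ, fun a _ b _ p q hp hq hpq => ?_⟩
    have := hc.2 (Set.mem_univ (x + a • (y - x))) (Set.mem_univ (x + b • (y - x))) hp hq hpq
    refine le_trans (le_of_eq ?_) this
    change g _ = g _
    congr 1
    obtain rfl : p = 1 - q := by linarith
    simp only [smul_eq_mul]
    module
  have := hconv.le_slope_of_hasDerivAt (Set.mem_univ 0) (Set.mem_univ 1) one_pos h0
  simp only [slope_def_field, zero_smul, one_smul, add_zero, add_sub_cancel, sub_zero,
    div_one] at this
  linarith

theorem le_add_inner_gradient_add_sq {L : ℝ≥0} (hd : Differentiable ℝ g)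
    (hs : LipschitzWith L (gradient g)) (x u : E) :
    g (x + u) ≤ g x + inner ℝ (gradient g x) u + L / 2 * ‖u‖ ^ 2 := by
  let φ : ℝ → ℝ := fun s => g (x + s • u) - s * inner ℝ (gradient g x) u - L / 2 * ‖u‖ ^ 2 * s ^ 2
  have hφ : ∀ s, HasDerivAt φ (inner ℝ (gradient g (x + s • u)) u
      - inner ℝ (gradient g x) u - L / 2 * ‖u‖ ^ 2 * (2 * s)) s := by
    intro s
    have h1 := (hasDerivAt_along_line hd x u s).sub
      ((hasDerivAt_id s).mul_const (inner ℝ (gradient g x) u))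
    have h2 := h1.sub (((hasDerivAt_pow 2 s)).const_mul (L / 2 * ‖u‖ ^ 2))
    refine h2.congr_deriv ?_
    simp
  have hanti : AntitoneOn φ (Set.Ici 0) := by
    refine antitoneOn_of_deriv_nonpos (convex_Ici 0)
      (fun s _ => (hφ s).continuousAt.continuousWithinAt)
      (fun s _ => (hφ s).differentiableAt.differentiableWithinAt) fun s hs' => ?_
    rw [interior_Ici, Set.mem_Ioi] at hs'
    rw [(hφ s).deriv, ← inner_sub_left]
    have h1 := real_inner_le_norm (gradient g (x + s • u) - gradient g x) u
    have h2 := hs.norm_sub_le (x + s • u) x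
    rw [add_sub_cancel_left, norm_smul, Real.norm_of_nonneg hs'.le] at h2
    have h3 := mul_le_mul_of_nonneg_right h2 (norm_nonneg u)
    nlinarith
  have := hanti (Set.self_mem_Ici) (Set.mem_Ici.2 zero_le_one) zero_le_one
  simp only [φ, one_smul, zero_smul, add_zero] at this
  linarith

/-- Cocoercivity of the gradient of a smooth convex function, in Bregman form. -/
theorem ConvexOn.sq_norm_gradient_sub_le {L : ℝ≥0} (hc : ConvexOn ℝ Set.univ g)
    (hd : Differentiable ℝ g) (hs : LipschitzWith L (gradient g)) (x y : E) :
    ‖gradient g y - gradient g x‖ ^ 2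
      ≤ 2 * L * (g y - g x - inner ℝ (gradient g x) (y - x)) := by
  set D := gradient g y - gradient g x with hD
  -- Compare, at the point `y - s D`, the tangent lower bound taken at `x` with the quadratic upper
  -- bound taken at `y`.
  have key : ∀ s : ℝ, 0 ≤ g y - g x - inner ℝ (gradient g x) (y - x) - s * ‖D‖ ^ 2
      + L / 2 * s ^ 2 * ‖D‖ ^ 2 := by
    intro s
    have h1 := hc.add_inner_gradient_le hd x (y + (-s) • D)
    have h2 := le_add_inner_gradient_add_sq hd hs y ((-s) • D)
    have h3 : inner ℝ (gradient g y) D - inner ℝ (gradient g x) D = ‖D‖ ^ 2 := by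
      rw [← inner_sub_left, ← hD, real_inner_self_eq_norm_sq]
    rw [add_sub_right_comm, inner_add_right, inner_smul_right] at h1
    rw [norm_smul, mul_pow, inner_smul_right, Real.norm_eq_abs, sq_abs] at h2
    have h4 : s * inner ℝ (gradient g y) D - s * inner ℝ (gradient g x) D = s * ‖D‖ ^ 2 := by
      rw [← mul_sub, h3]
    linarith
  rcases eq_or_lt_of_le L.2 with h0 | hpos
  · have h := hs.norm_sub_le y x
    have h0' : (L : ℝ) = 0 := h0.symm
    rw [h0', zero_mul] at h
    have : ‖D‖ = 0 := le_antisymm h (norm_nonneg _)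
    simp [this, h0']
  · have hpos' : (0 : ℝ) < L := hpos
    -- `s = 1/L` minimizes the quadratic in `key`.
    have h := key (1 / L)
    have h2 : (L : ℝ) / 2 * (1 / L) ^ 2 * ‖D‖ ^ 2 = ‖D‖ ^ 2 / (2 * L) := by field_simp
    have h3 : 1 / (L : ℝ) * ‖D‖ ^ 2 = 2 * (‖D‖ ^ 2 / (2 * L)) := by field_simp
    rw [h2, h3] at h
    have h4 : ‖D‖ ^ 2 / (2 * L) ≤ g y - g x - inner ℝ (gradient g x) (y - x) := by linarith
    rw [div_le_iff₀ (by positivity)] at h4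
    linarith

theorem norm_gradient_le_of_lipschitz {G : ℝ≥0} (hl : LipschitzWith G g) (x : E) :
    ‖gradient g x‖ ≤ G := by
  rw [gradient, LinearIsometryEquiv.norm_map]
  exact norm_fderiv_le_of_lipschitz ℝ hl

theorem gradient_add_half_mul_sq_norm (hd : Differentiable ℝ g) (μ : ℝ) (w : E) :
    gradient (fun u => g u + μ / 2 * ‖u‖ ^ 2) w = gradient g w + μ • w := by
  refine HasGradientAt.gradient ?_
  rw [hasGradientAt_iff_hasFDerivAt]
  have h1 := (hd w).hasFDerivAt
  have h2 := ((hasStrictFDerivAt_norm_sq w).hasFDerivAt).const_mul (μ / 2)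
  refine (h1.add h2).congr_fderiv ?_
  ext y
  simp
  ring

end SmoothConvex

/-! ### The uncertainty set: compactness, convexity, elementary bounds. -/

section Permutahedron

variable {n : ℕ}

theorem isCompact_permutahedron (σ : Fin n → ℝ) : IsCompact (permutahedron σ) :=
  (Set.finite_range _).isCompact_convexHull ℝ

theorem convex_permutahedron (σ : Fin n → ℝ) : Convex ℝ (permutahedron σ) :=
  convex_convexHull ℝ _

theorem permutahedron_nonempty (σ : Fin n → ℝ) : (permutahedron σ).Nonempty :=
  ⟨_, subset_convexHull ℝ _ ⟨1, rfl⟩⟩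

variable [NeZero n] {σ : Fin n → ℝ}

theorem permutahedron_bounds (hσ : IsSpectrum σ) {q : Fin n → ℝ} (hq : q ∈ permutahedron σ) :
    (∀ i, 0 ≤ q i) ∧ (∀ i, q i ≤ σ ⊤) ∧ ∑ i, q i = 1 := by
  have hsub : permutahedron σ ⊆ {q | (∀ i, 0 ≤ q i) ∧ (∀ i, q i ≤ σ ⊤) ∧ ∑ i, q i = 1} := by
    refine convexHull_min ?_ ?_
    · rintro _ ⟨π, rfl⟩
      refine ⟨fun i => hσ.nonneg _, fun i => hσ.mono le_top, ?_⟩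
      rw [← hσ.sum_eq_one]
      exact Equiv.sum_comp π σ
    · rintro x ⟨hx0, hx1, hx2⟩ y ⟨hy0, hy1, hy2⟩ a b ha hb hab
      refine ⟨fun i => ?_, fun i => ?_, ?_⟩
      · exact add_nonneg (mul_nonneg ha (hx0 i)) (mul_nonneg hb (hy0 i))
      · have h1 := mul_le_mul_of_nonneg_left (hx1 i) ha
        have h2 := mul_le_mul_of_nonneg_left (hy1 i) hb
        calc a * x i + b * y i ≤ (a + b) * σ ⊤ := by linarith
          _ = σ ⊤ := by rw [hab, one_mul]
      · simp only [Pi.add_apply, Pi.smul_apply, smul_eq_mul, Finset.sum_add_distrib,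
          ← Finset.mul_sum, hx2, hy2]
        linarith
  exact hsub hq

theorem IsSpectrum.top_le_one (hσ : IsSpectrum σ) : σ ⊤ ≤ 1 := by
  rw [← hσ.sum_eq_one]
  exact Finset.single_le_sum (fun i _ => hσ.nonneg i) (Finset.mem_univ _)

theorem IsSpectrum.one_le_mul_top (hσ : IsSpectrum σ) : 1 ≤ n * σ ⊤ := by
  rw [← hσ.sum_eq_one]
  calc ∑ i, σ i ≤ ∑ _i : Fin n, σ ⊤ := Finset.sum_le_sum fun i _ => hσ.mono le_top
    _ = n * σ ⊤ := by simp

theorem natCast_mul_mem_Icc_of_mem_permutahedron (hσ : IsSpectrum σ) {q : Fin n → ℝ}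
    (hq : q ∈ permutahedron σ) (i : Fin n) : (n : ℝ) * q i ∈ Set.Icc 0 (n : ℝ) := by
  obtain ⟨h0, h1, -⟩ := permutahedron_bounds hσ hq
  exact ⟨mul_nonneg (Nat.cast_nonneg n) (h0 i), mul_le_of_le_one_right (Nat.cast_nonneg n)
    ((h1 i).trans hσ.top_le_one)⟩

end Permutahedron

/-! ### The dual maximizer and the spectral risk. -/

section Dual

variable {n : ℕ} {σ : Fin n → ℝ} {f : ℝ → ℝ} {ν α : ℝ}

theorem spectralRisk_eq {l q : Fin n → ℝ} (hq : IsDualMaximizer σ f ν l q) :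
    spectralRisk σ f ν l = penalizedLoss f ν l q :=
  IsGreatest.csSup_eq ⟨⟨q, hq.1, rfl⟩, by rintro _ ⟨p, hp, rfl⟩; exact hq.2 hp⟩

variable [NeZero n]

/-- Convexity alone gives continuity only in the interior; the limit condition supplies the endpoint
`0`, which is reached when some weight vanishes. -/
theorem IsDivergenceGenerator.continuousOn (hf : IsDivergenceGenerator f) :
    ContinuousOn f (Set.Ici 0) := by
  intro x hx
  rcases eq_or_lt_of_le (Set.mem_Ici.1 hx) with rfl | hpos
  · rw [← Set.Ioi_insert, continuousWithinAt_insert_self]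
    exact hf.tendsto_zero
  · have h := hf.convex.continuousOn_interior
    rw [interior_Ici] at h
    exact (h.continuousAt (Ioi_mem_nhds hpos)).continuousWithinAt

theorem continuousOn_penalizedLoss (hσ : IsSpectrum σ) (hf : IsDivergenceGenerator f)
    (l : Fin n → ℝ) : ContinuousOn (penalizedLoss f ν l) (permutahedron σ) := by
  unfold penalizedLoss fDivUniform
  refine ContinuousOn.sub (Continuous.continuousOn (by fun_prop))
    (continuousOn_const.mul (continuousOn_const.mul (continuousOn_finsetSum _ fun i _ => ?_)))
  refine hf.continuousOn.comp (Continuous.continuousOn (by fun_prop)) fun q hq => ?_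
  exact (natCast_mul_mem_Icc_of_mem_permutahedron hσ hq i).1

/-- Strong concavity of the penalized loss with modulus `n α ν`. -/
theorem penalizedLoss_strongConcave (hσ : IsSpectrum σ) (hν : 0 ≤ ν)
    (hfα : StrongConvexOn (Set.Icc 0 (n : ℝ)) α f) (l : Fin n → ℝ) {p q : Fin n → ℝ}
    (hp : p ∈ permutahedron σ) (hq : q ∈ permutahedron σ) {a b : ℝ} (ha : 0 ≤ a) (hb : 0 ≤ b)
    (hab : a + b = 1) :
    a * penalizedLoss f ν l p + b * penalizedLoss f ν l q
        + a * b * (n * α * ν / 2 * ∑ i, (p i - q i) ^ 2)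
      ≤ penalizedLoss f ν l (a • p + b • q) := by
  have hn : (0 : ℝ) < n := Nat.cast_pos.2 (NeZero.pos n)
  have h1 : ∀ i, f (n * (a • p + b • q) i)
      ≤ a * f (n * p i) + b * f (n * q i) - a * b * (α / 2 * (n ^ 2 * (p i - q i) ^ 2)) := by
    intro i
    have h := hfα.2 (natCast_mul_mem_Icc_of_mem_permutahedron hσ hp i)
      (natCast_mul_mem_Icc_of_mem_permutahedron hσ hq i) ha hb hab
    have e1 : a • ((n : ℝ) * p i) + b • (n * q i) = n * (a • p + b • q) i := by
      simp; ring
    rw [e1, ← mul_sub] at h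
    beta_reduce at h
    rw [Real.norm_eq_abs, sq_abs, mul_pow] at h
    exact h
  have h2 := Finset.sum_le_sum fun i (_ : i ∈ Finset.univ) => h1 i
  simp only [Finset.sum_sub_distrib, Finset.sum_add_distrib, ← Finset.mul_sum] at h2
  have h3 := mul_le_mul_of_nonneg_left h2 (by positivity : 0 ≤ ν * (1 / n))
  have h4 : ∑ i, (a • p + b • q) i * l i = a * ∑ i, p i * l i + b * ∑ i, q i * l i := by
    simp only [Pi.add_apply, Pi.smul_apply, smul_eq_mul, add_mul, Finset.sum_add_distrib,
      Finset.mul_sum, mul_assoc]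
  have h5 : ν * (1 / n) * (a * b * (α / 2 * (n ^ 2 * ∑ i, (p i - q i) ^ 2)))
      = a * b * (n * α * ν / 2 * ∑ i, (p i - q i) ^ 2) := by
    field_simp
  unfold penalizedLoss fDivUniform
  rw [h4]
  rw [mul_sub, h5] at h3
  linarith

theorem exists_isDualMaximizer (hσ : IsSpectrum σ) (hf : IsDivergenceGenerator f)
    (l : Fin n → ℝ) : ∃ q, IsDualMaximizer σ f ν l q :=
  (isCompact_permutahedron σ).exists_isMaxOn (permutahedron_nonempty σ)
    (continuousOn_penalizedLoss hσ hf l)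

theorem isDualMaximizer_qOpt (hσ : IsSpectrum σ) (hf : IsDivergenceGenerator f)
    (l : Fin n → ℝ) : IsDualMaximizer σ f ν l (qOpt σ f ν l) :=
  Classical.epsilon_spec (exists_isDualMaximizer hσ hf l)

/-- Moving from the maximizer a fraction `t` of the way to `p` cannot increase the value. Strong
concavity, after division by `t`, gives the bound with `(1 - t) K`; then `t → 0`. -/
theorem IsDualMaximizer.quadratic_growth (hσ : IsSpectrum σ) (hν : 0 ≤ ν)
    (hfα : StrongConvexOn (Set.Icc 0 (n : ℝ)) α f) {l p q : Fin n → ℝ}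
    (hq : IsDualMaximizer σ f ν l q) (hp : p ∈ permutahedron σ) :
    penalizedLoss f ν l p + n * α * ν / 2 * ∑ i, (p i - q i) ^ 2 ≤ penalizedLoss f ν l q := by
  set K := n * α * ν / 2 * ∑ i, (p i - q i) ^ 2
  have key : ∀ t : ℝ, 0 < t → t ≤ 1 →
      penalizedLoss f ν l p + (1 - t) * K ≤ penalizedLoss f ν l q := by
    intro t ht ht1
    have h := penalizedLoss_strongConcave hσ hν hfα l hp hq.1 ht.le (sub_nonneg.2 ht1)
      (by ring)
    have h2 := hq.2 (convex_permutahedron σ hp hq.1 ht.le (sub_nonneg.2 ht1) (by ring))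
    simp only [Set.mem_ofPred_eq] at h2
    change _ + t * (1 - t) * K ≤ _ at h
    have h3 : t * (penalizedLoss f ν l p + (1 - t) * K) ≤ t * penalizedLoss f ν l q := by
      linarith
    exact le_of_mul_le_mul_left h3 ht
  have hlim : Filter.Tendsto (fun t : ℝ => penalizedLoss f ν l p + (1 - t) * K) (𝓝[>] 0)
      (𝓝 (penalizedLoss f ν l p + (1 - 0) * K)) :=
    (Continuous.tendsto (by fun_prop) 0).mono_left nhdsWithin_le_nhds
  rw [sub_zero, one_mul] at hlim
  refine le_of_tendsto hlim ?_
  filter_upwards [Ioc_mem_nhdsGT one_pos] with t ht using key t ht.1 ht.2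

/-- Add the quadratic growth bounds at the two maximizers, each tested at the other: the divergence
terms cancel. This is strong monotonicity of the argmax map, the source of uniqueness, of Lipschitz
weights and of the favourable sign of the coupling term. -/
theorem IsDualMaximizer.monotone (hσ : IsSpectrum σ) (hν : 0 ≤ ν)
    (hfα : StrongConvexOn (Set.Icc 0 (n : ℝ)) α f) {l l' q q' : Fin n → ℝ}
    (hq : IsDualMaximizer σ f ν l q) (hq' : IsDualMaximizer σ f ν l' q') :
    n * α * ν * ∑ i, (q i - q' i) ^ 2 ≤ ∑ i, (q i - q' i) * (l i - l' i) := by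
  have h1 := hq.quadratic_growth hσ hν hfα hq'.1
  have h2 := hq'.quadratic_growth hσ hν hfα hq.1
  have h3 : ∑ i, (q' i - q i) ^ 2 = ∑ i, (q i - q' i) ^ 2 :=
    Finset.sum_congr rfl fun i _ => by ring
  have h4 : ∑ i, (q i - q' i) * (l i - l' i)
      = ∑ i, q i * l i - ∑ i, q' i * l i + ∑ i, q' i * l' i - ∑ i, q i * l' i := by
    simp only [← Finset.sum_sub_distrib, ← Finset.sum_add_distrib]
    exact Finset.sum_congr rfl fun i _ => by ring
  rw [h3] at h1
  unfold penalizedLoss at h1 h2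
  linarith

theorem IsDualMaximizer.eq (hσ : IsSpectrum σ) (hν : 0 < ν) (hα : 0 < α)
    (hfα : StrongConvexOn (Set.Icc 0 (n : ℝ)) α f) {l q q' : Fin n → ℝ}
    (hq : IsDualMaximizer σ f ν l q) (hq' : IsDualMaximizer σ f ν l q') : q = q' := by
  have hn : (0 : ℝ) < n := Nat.cast_pos.2 (NeZero.pos n)
  have h := hq.monotone hσ hν.le hfα hq'
  simp only [sub_self, mul_zero, Finset.sum_const_zero] at h
  have h0 : ∑ i, (q i - q' i) ^ 2 = 0 :=
    le_antisymm (nonpos_of_mul_nonpos_right h (by positivity))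
      (Finset.sum_nonneg fun i _ => sq_nonneg _)
  rw [Finset.sum_eq_zero_iff_of_nonneg fun i _ => sq_nonneg _] at h0
  funext i
  exact sub_eq_zero.1 (pow_eq_zero_iff two_ne_zero |>.1 (h0 i (Finset.mem_univ i)))

theorem penalizedLoss_le_spectralRisk (hσ : IsSpectrum σ) (hf : IsDivergenceGenerator f)
    (l : Fin n → ℝ) {p : Fin n → ℝ} (hp : p ∈ permutahedron σ) :
    penalizedLoss f ν l p ≤ spectralRisk σ f ν l := by
  rw [spectralRisk_eq (isDualMaximizer_qOpt hσ hf l)]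
  exact (isDualMaximizer_qOpt hσ hf l).2 hp

/-- Test both risks with the maximizer for `l`; its weights lie in `[0, 1]`. -/
theorem spectralRisk_sub_le (hσ : IsSpectrum σ) (hf : IsDivergenceGenerator f)
    (l l' : Fin n → ℝ) :
    spectralRisk σ f ν l - spectralRisk σ f ν l' ≤ ∑ i, |l i - l' i| := by
  have hq := isDualMaximizer_qOpt (ν := ν) hσ hf l
  obtain ⟨h0, h1, -⟩ := permutahedron_bounds hσ hq.1
  have h := penalizedLoss_le_spectralRisk (ν := ν) hσ hf l' hq.1
  rw [spectralRisk_eq hq]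
  have h2 : ∑ i, qOpt σ f ν l i * l i - ∑ i, qOpt σ f ν l i * l' i ≤ ∑ i, |l i - l' i| := by
    rw [← Finset.sum_sub_distrib]
    refine Finset.sum_le_sum fun i _ => ?_
    rw [← mul_sub]
    calc _ ≤ qOpt σ f ν l i * |l i - l' i| := mul_le_mul_of_nonneg_left (le_abs_self _) (h0 i)
      _ ≤ _ := mul_le_of_le_one_left (abs_nonneg _) ((h1 i).trans hσ.top_le_one)
  unfold penalizedLoss at *
  linarith

theorem continuous_spectralRisk (hσ : IsSpectrum σ) (hf : IsDivergenceGenerator f) :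
    Continuous (spectralRisk σ f ν) := by
  refine continuous_iff_continuousAt.2 fun l => ?_
  rw [ContinuousAt, tendsto_iff_norm_sub_tendsto_zero]
  have hlim : Filter.Tendsto (fun l' : Fin n → ℝ => ∑ i, |l' i - l i|) (𝓝 l) (𝓝 0) := by
    have : Continuous fun l' : Fin n → ℝ => ∑ i, |l' i - l i| := by fun_prop
    simpa using this.tendsto l
  refine squeeze_zero (fun _ => norm_nonneg _) (fun l' => ?_) hlim
  rw [Real.norm_eq_abs, abs_le]
  have h1 := spectralRisk_sub_le (ν := ν) hσ hf l l'
  have h2 := spectralRisk_sub_le (ν := ν) hσ hf l' l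
  simp only [abs_sub_comm (l _) (l' _)] at h1
  exact ⟨by linarith, h2⟩

end Dual

/-! ### Existence of a minimizer, Lipschitz weights, first-order optimality. -/

section Objective

variable {n d : ℕ} [NeZero n] {ℓ : Fin n → EuclideanSpace ℝ (Fin d) → ℝ} {σ : Fin n → ℝ}
  {f : ℝ → ℝ} {G : ℝ≥0} {μ ν α : ℝ}

theorem exists_isMinOn_objective (hμ : 0 < μ) (hlip : ∀ k, LipschitzWith G (ℓ k))
    (hσ : IsSpectrum σ) (hf : IsDivergenceGenerator f) :
    ∃ w, IsMinOn (objective ℓ σ f ν μ) Set.univ w := by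
  have hcont : Continuous (objective ℓ σ f ν μ) := by
    unfold objective
    exact ((continuous_spectralRisk hσ hf).comp
      (continuous_pi fun k => (hlip k).continuous)).add (by fun_prop)
  obtain ⟨q, hq⟩ := permutahedron_nonempty σ
  obtain ⟨h0, -, h2⟩ := permutahedron_bounds hσ hq
  -- Coercivity: fixing one feasible `q`, the losses fall at most linearly at rate `G`, while the
  -- regularizer is quadratic.
  have hlow : ∀ w, penalizedLoss f ν (fun k => ℓ k 0) q + (μ / 2 * ‖w‖ - G) * ‖w‖
      ≤ objective ℓ σ f ν μ w := by
    intro w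
    have h := penalizedLoss_le_spectralRisk (ν := ν) hσ hf (fun k => ℓ k w) hq
    have h3 : ∑ i, q i * ℓ i 0 - G * ‖w‖ ≤ ∑ i, q i * ℓ i w := by
      have : (G : ℝ) * ‖w‖ = ∑ i, q i * (G * ‖w‖) := by rw [← Finset.sum_mul, h2, one_mul]
      rw [this, ← Finset.sum_sub_distrib]
      refine Finset.sum_le_sum fun i _ => ?_
      rw [← mul_sub]
      refine mul_le_mul_of_nonneg_left ?_ (h0 i)
      have := (hlip i).norm_sub_le 0 w
      rw [zero_sub, norm_neg, Real.norm_eq_abs] at this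
      linarith [le_abs_self (ℓ i 0 - ℓ i w)]
    unfold objective
    unfold penalizedLoss at *
    linarith
  have hnorm : Filter.Tendsto (fun w : EuclideanSpace ℝ (Fin d) => ‖w‖)
      (Filter.cocompact _) Filter.atTop := tendsto_norm_cocompact_atTop
  have htop : Filter.Tendsto (fun r : ℝ =>
      penalizedLoss f ν (fun k => ℓ k 0) q + (μ / 2 * r - G) * r) Filter.atTop Filter.atTop := by
    refine Filter.tendsto_atTop_add_const_left _ _ (Filter.Tendsto.atTop_mul_atTop₀ ?_
      Filter.tendsto_id)
    exact Filter.tendsto_atTop_add_const_right _ _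
      (Filter.tendsto_id.const_mul_atTop (by positivity))
  have hev := (htop.comp hnorm).eventually_ge_atTop (objective ℓ σ f ν μ 0)
  obtain ⟨w, hw⟩ := hcont.exists_forall_le' 0 (hev.mono fun w hw => hw.trans (hlow w))
  exact ⟨w, fun y _ => hw y⟩

/-- Lipschitz continuity of the weights, in terms of the points at which losses are evaluated. -/
theorem IsDualMaximizer.sq_dist_le (hσ : IsSpectrum σ) (hν : 0 ≤ ν) (hα : 0 ≤ α)
    (hfα : StrongConvexOn (Set.Icc 0 (n : ℝ)) α f) (hlip : ∀ k, LipschitzWith G (ℓ k))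
    {x y : Fin n → EuclideanSpace ℝ (Fin d)} {q q' : Fin n → ℝ}
    (hq : IsDualMaximizer σ f ν (fun k => ℓ k (x k)) q)
    (hq' : IsDualMaximizer σ f ν (fun k => ℓ k (y k)) q') :
    (n * α * ν) ^ 2 * ∑ i, (q i - q' i) ^ 2 ≤ G ^ 2 * ∑ i, ‖x i - y i‖ ^ 2 := by
  have h1 := hq.monotone hσ hν hfα hq'
  set D := ∑ i, (q i - q' i) ^ 2 with hD
  have hD0 : 0 ≤ D := Finset.sum_nonneg fun i _ => sq_nonneg _
  have h2 := Finset.sum_mul_sq_le_sq_mul_sq Finset.univ (fun i => q i - q' i)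
    (fun i => ℓ i (x i) - ℓ i (y i))
  have h3 : ∑ i, (ℓ i (x i) - ℓ i (y i)) ^ 2 ≤ G ^ 2 * ∑ i, ‖x i - y i‖ ^ 2 := by
    rw [Finset.mul_sum]
    refine Finset.sum_le_sum fun i _ => ?_
    rw [← mul_pow, ← sq_abs]
    exact pow_le_pow_left₀ (abs_nonneg _) ((hlip i).norm_sub_le _ _) 2
  have h4 : (n * α * ν * D) ^ 2 ≤ D * (G ^ 2 * ∑ i, ‖x i - y i‖ ^ 2) :=
    (pow_le_pow_left₀ (by positivity) h1 2).trans
      (h2.trans (mul_le_mul_of_nonneg_left h3 hD0))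
  rcases eq_or_lt_of_le hD0 with h0 | hpos
  · rw [← h0, mul_zero]; positivity
  · refine le_of_mul_le_mul_left ?_ hpos
    linarith [h4]

/-- First-order optimality: the gradients at the minimizer, weighted by its dual weights, cancel. -/
theorem sum_qOpt_smul_gradient_eq_zero (hν : 0 < ν) (hα : 0 < α)
    (hlip : ∀ k, LipschitzWith G (ℓ k)) (hdiff : ∀ k, Differentiable ℝ (ℓ k)) (hσ : IsSpectrum σ)
    (hf : IsDivergenceGenerator f) (hfα : StrongConvexOn (Set.Icc 0 (n : ℝ)) α f)
    {w : EuclideanSpace ℝ (Fin d)} (hw : IsMinOn (objective ℓ σ f ν μ) Set.univ w) :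
    ∑ k, qOpt σ f ν (fun i => ℓ i w) k • gradReg ℓ μ k w = 0 := by
  have hn : (0 : ℝ) < n := Nat.cast_pos.2 (NeZero.pos n)
  set q := qOpt σ f ν (fun i => ℓ i w)
  set h := ∑ k, q k • gradReg ℓ μ k w with hh
  let p : ℝ → Fin n → ℝ := fun s => qOpt σ f ν (fun i => ℓ i (w + s • -h))
  let r : Fin n → EuclideanSpace ℝ (Fin d) → ℝ := fun k u => ℓ k u + μ / 2 * ‖u‖ ^ 2
  have hr : ∀ k, Differentiable ℝ (r k) := fun k => (hdiff k).add
    ((differentiable_id.norm_sq ℝ).const_mul _)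
  -- Danskin's argument without differentiating the risk: the weights optimal at the moved point are
  -- exact there and give only a lower bound at `w`, so minimality of `w` passes to the weighted
  -- loss increments. The limit `s → 0+` along `-h` then yields `0 ≤ -‖h‖²`.
  have hkey : ∀ s, 0 < s → 0 ≤ ∑ k, p s k * (s⁻¹ * (r k (w + s • -h) - r k w)) := by
    intro s hs
    have hp : IsDualMaximizer σ f ν (fun i => ℓ i (w + s • -h)) (p s) :=
      isDualMaximizer_qOpt hσ hf _
    obtain ⟨-, -, hsum⟩ := permutahedron_bounds hσ hp.1
    have h1 : objective ℓ σ f ν μ w ≤ objective ℓ σ f ν μ (w + s • -h) := hw (Set.mem_univ _)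
    have h2 := penalizedLoss_le_spectralRisk (ν := ν) hσ hf (fun k => ℓ k w) hp.1
    unfold objective at h1
    rw [spectralRisk_eq hp] at h1
    have h3 : ∑ k, p s k * (r k (w + s • -h) - r k w)
        = ∑ k, p s k * ℓ k (w + s • -h) - ∑ k, p s k * ℓ k w
          + (∑ k, p s k) * (μ / 2 * ‖w + s • -h‖ ^ 2 - μ / 2 * ‖w‖ ^ 2) := by
      rw [Finset.sum_mul, ← Finset.sum_sub_distrib, ← Finset.sum_add_distrib]
      exact Finset.sum_congr rfl fun k _ => by simp only [r]; ring
    have h4 : ∑ k, p s k * (s⁻¹ * (r k (w + s • -h) - r k w))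
        = s⁻¹ * ∑ k, p s k * (r k (w + s • -h) - r k w) := by
      rw [Finset.mul_sum]
      exact Finset.sum_congr rfl fun k _ => by ring
    rw [h4]
    refine mul_nonneg (inv_nonneg.2 hs.le) ?_
    rw [h3, hsum]
    unfold penalizedLoss at *
    linarith
  have hp_lim : ∀ k, Filter.Tendsto (fun s => p s k) (𝓝[>] 0) (𝓝 (q k)) := by
    intro k
    rw [tendsto_iff_norm_sub_tendsto_zero]
    have hlim : Filter.Tendsto
        (fun s : ℝ => Real.sqrt (G ^ 2 * (n * ‖s • -h‖ ^ 2) / (n * α * ν) ^ 2))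
        (𝓝[>] 0) (𝓝 0) := by
      have : Continuous fun s : ℝ =>
        Real.sqrt (G ^ 2 * (n * ‖s • -h‖ ^ 2) / (n * α * ν) ^ 2) := by fun_prop
      simpa using (this.tendsto 0).mono_left (nhdsWithin_le_nhds (s := Set.Ioi 0))
    refine squeeze_zero (fun _ => norm_nonneg _) (fun s => ?_) hlim
    rw [Real.norm_eq_abs]
    refine Real.abs_le_sqrt ?_
    rw [le_div_iff₀ (by positivity)]
    have h1 := IsDualMaximizer.sq_dist_le (x := fun _ => w + s • -h) (y := fun _ => w) hσ hν.le
      hα.le hfα hlip (isDualMaximizer_qOpt hσ hf _) (isDualMaximizer_qOpt hσ hf _)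
    simp only [add_sub_cancel_left, Finset.sum_const, Finset.card_univ, Fintype.card_fin,
      nsmul_eq_mul] at h1
    refine le_trans ?_ h1
    rw [mul_comm]
    refine mul_le_mul_of_nonneg_left ?_ (sq_nonneg _)
    exact Finset.single_le_sum (f := fun i => (p s i - q i) ^ 2) (fun i _ => sq_nonneg _)
      (Finset.mem_univ k)
  have hr_lim : ∀ k, Filter.Tendsto (fun s : ℝ => s⁻¹ * (r k (w + s • -h) - r k w)) (𝓝[>] 0)
      (𝓝 (inner ℝ (gradReg ℓ μ k w) (-h))) := by
    intro k
    have h1 := hasDerivAt_along_line (hr k) w (-h) 0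
    rw [zero_smul, add_zero, hasDerivAt_iff_tendsto_slope_zero] at h1
    have h2 := h1.mono_left (nhdsWithin_mono 0 fun s (hs : s ∈ Set.Ioi (0 : ℝ)) =>
      (Set.mem_Ioi.1 hs).ne')
    simp only [zero_add, zero_smul, add_zero, smul_eq_mul] at h2
    exact h2
  have hlim := tendsto_finsetSum Finset.univ fun k _ => (hp_lim k).mul (hr_lim k)
  have hge : 0 ≤ ∑ k, q k * inner ℝ (gradReg ℓ μ k w) (-h) := by
    refine ge_of_tendsto hlim ?_
    filter_upwards [self_mem_nhdsWithin] with s hs using hkey s hs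
  have h5 : ∑ k, q k * inner ℝ (gradReg ℓ μ k w) (-h) = -‖h‖ ^ 2 := by
    rw [← real_inner_self_eq_norm_sq, ← inner_neg_right]
    conv_rhs => rw [hh, sum_inner]
    exact Finset.sum_congr rfl fun k _ => by rw [real_inner_smul_left]
  rw [h5] at hge
  have : ‖h‖ ^ 2 = 0 := le_antisymm (by linarith) (sq_nonneg _)
  exact norm_eq_zero.1 (pow_eq_zero_iff two_ne_zero |>.1 this)

end Objective

/-! ### Finite-sum identities and Young inequalities. -/

section FiniteSums

variable {n : ℕ} {V : Type*}

/-- Over the `n` choices of `j`, each coordinate is refreshed once and kept `n - 1` times. This is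
what produces every factor `1 - 1/n` below. -/
theorem sum_sum_update (φ : Fin n → V → ℝ) (ζ : Fin n → V) (x : Fin n → V) :
    ∑ j, ∑ k, φ k (Function.update ζ j (x j) k) = (n - 1) * ∑ k, φ k (ζ k) + ∑ k, φ k (x k) := by
  have h : ∀ j, ∑ k, φ k (Function.update ζ j (x j) k)
      = ∑ k, φ k (ζ k) + (φ j (x j) - φ j (ζ j)) := by
    intro j
    rw [← Finset.add_sum_erase _ _ (Finset.mem_univ j),
      ← Finset.add_sum_erase Finset.univ (fun k => φ k (ζ k)) (Finset.mem_univ j),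
      Function.update_self,
      Finset.sum_congr rfl fun k hk => by rw [Function.update_of_ne (Finset.ne_of_mem_erase hk)]]
    ring
  simp only [h, Finset.sum_add_distrib, Finset.sum_sub_distrib, Finset.sum_const,
    Finset.card_univ, Fintype.card_fin, nsmul_eq_mul]
  ring

variable [NormedAddCommGroup V] [InnerProductSpace ℝ V]

theorem sum_sq_norm_sub_mean_le (Y : Fin n → V) (m : V) (hm : ∑ k, Y k = (n : ℝ) • m) :
    ∑ k, ‖Y k - m‖ ^ 2 ≤ ∑ k, ‖Y k‖ ^ 2 := by
  have h : ∑ k, inner ℝ (Y k) m = n * ‖m‖ ^ 2 := by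
    rw [← sum_inner, hm, real_inner_smul_left, real_inner_self_eq_norm_sq]
  simp only [norm_sub_sq_real, Finset.sum_add_distrib, Finset.sum_sub_distrib, ← Finset.mul_sum, h,
    Finset.sum_const, Finset.card_univ, Fintype.card_fin, nsmul_eq_mul]
  have : 0 ≤ (n : ℝ) * ‖m‖ ^ 2 := by positivity
  linarith

theorem sq_norm_add_le_young (x y : V) {s : ℝ} (hs : 0 < s) :
    ‖x + y‖ ^ 2 ≤ (1 + s) * ‖x‖ ^ 2 + (1 + s⁻¹) * ‖y‖ ^ 2 := by
  have h : 0 ≤ ‖s • x - y‖ ^ 2 := sq_nonneg _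
  rw [norm_sub_sq_real, norm_smul, real_inner_smul_left, Real.norm_of_nonneg hs.le] at h
  rw [norm_add_sq_real]
  have h2 := mul_le_mul_of_nonneg_left h (inv_nonneg.2 hs.le)
  have h3 : s⁻¹ * ((s * ‖x‖) ^ 2 - 2 * (s * inner ℝ x y) + ‖y‖ ^ 2)
      = s * ‖x‖ ^ 2 - 2 * inner ℝ x y + s⁻¹ * ‖y‖ ^ 2 := by field_simp
  rw [h3] at h2
  linarith

theorem sq_norm_add_le (x y : V) : ‖x + y‖ ^ 2 ≤ 2 * ‖x‖ ^ 2 + 2 * ‖y‖ ^ 2 := by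
  have := sq_norm_add_le_young x y one_pos
  norm_num at this
  linarith

theorem sq_norm_sub_le (x y : V) : ‖x - y‖ ^ 2 ≤ 2 * ‖x‖ ^ 2 + 2 * ‖y‖ ^ 2 := by
  simpa [sub_eq_add_neg] using sq_norm_add_le x (-y)

end FiniteSums

theorem abs_sum_mul_le_young {ι : Type*} (s : Finset ι) (x y : ι → ℝ) {c : ℝ} (hc : 0 < c) :
    |∑ i ∈ s, x i * y i| ≤ c / 2 * ∑ i ∈ s, x i ^ 2 + (2 * c)⁻¹ * ∑ i ∈ s, y i ^ 2 := by
  rw [Finset.mul_sum, Finset.mul_sum, ← Finset.sum_add_distrib]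
  refine (Finset.abs_sum_le_sum_abs _ _).trans (Finset.sum_le_sum fun i _ => ?_)
  have h : c / 2 * x i ^ 2 + (2 * c)⁻¹ * y i ^ 2 - |x i * y i|
      = (2 * c)⁻¹ * (c * |x i| - |y i|) ^ 2 := by
    rw [abs_mul, ← sq_abs (x i), ← sq_abs (y i)]
    field_simp
    ring
  have : 0 ≤ (2 * c)⁻¹ * (c * |x i| - |y i|) ^ 2 := by positivity
  linarith

/-! ### Regularized losses and the saddle-point inequality. -/

section RegularizedLosses

variable {n d : ℕ} {ℓ : Fin n → EuclideanSpace ℝ (Fin d) → ℝ} {G L : ℝ≥0} {μ : ℝ}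

theorem gradReg_eq (hdiff : ∀ k, Differentiable ℝ (ℓ k)) (k : Fin n)
    (w : EuclideanSpace ℝ (Fin d)) : gradReg ℓ μ k w = gradient (ℓ k) w + μ • w :=
  gradient_add_half_mul_sq_norm (hdiff k) μ w

/-- The Bregman divergence of `ℓ k` between `u` and `w`. -/
noncomputable def bregman (ℓ : Fin n → EuclideanSpace ℝ (Fin d) → ℝ) (k : Fin n)
    (u w : EuclideanSpace ℝ (Fin d)) : ℝ :=
  ℓ k u - ℓ k w - inner ℝ (gradient (ℓ k) w) (u - w)

theorem bregman_nonneg (hconv : ∀ k, ConvexOn ℝ Set.univ (ℓ k))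
    (hdiff : ∀ k, Differentiable ℝ (ℓ k)) (k : Fin n) (u w : EuclideanSpace ℝ (Fin d)) :
    0 ≤ bregman ℓ k u w := by
  have := (hconv k).add_inner_gradient_le (hdiff k) w u
  unfold bregman
  linarith

/-- Cocoercivity of `∇ℓ_k` plus Young's inequality with parameter `L/(2μ)`, the ratio for which both
resulting terms carry the common factor `L + 2μ`. When `L = 0` this parameter degenerates, but then
`∇ℓ_k` is constant. -/
theorem sq_norm_gradReg_sub_le (hμ : 0 < μ) (hconv : ∀ k, ConvexOn ℝ Set.univ (ℓ k))
    (hdiff : ∀ k, Differentiable ℝ (ℓ k)) (hsmooth : ∀ k, LipschitzWith L (gradient (ℓ k)))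
    (k : Fin n) (u w : EuclideanSpace ℝ (Fin d)) :
    ‖gradReg ℓ μ k w - gradReg ℓ μ k u‖ ^ 2
      ≤ (L + 2 * μ) * (2 * bregman ℓ k u w + μ / 2 * ‖w - u‖ ^ 2) := by
  have h1 := (hconv k).sq_norm_gradient_sub_le (hdiff k) (hsmooth k) w u
  have h0 := bregman_nonneg hconv hdiff k u w
  change _ ≤ 2 * (L : ℝ) * bregman ℓ k u w at h1
  have e1 : gradReg ℓ μ k w - gradReg ℓ μ k u
      = μ • (w - u) + -(gradient (ℓ k) u - gradient (ℓ k) w) := by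
    rw [gradReg_eq hdiff, gradReg_eq hdiff]; module
  have hL : (0 : ℝ) ≤ L := L.2
  rw [e1]
  rcases eq_or_lt_of_le hL with hz | hpos
  · rw [← hz] at h1 ⊢
    have : gradient (ℓ k) u - gradient (ℓ k) w = 0 := by
      rw [mul_zero, zero_mul] at h1
      exact norm_eq_zero.1 (pow_eq_zero_iff two_ne_zero |>.1 (le_antisymm h1 (sq_nonneg _)))
    rw [this, neg_zero, add_zero, norm_smul, Real.norm_of_nonneg hμ.le]
    have := mul_nonneg hμ.le h0
    nlinarith
  · have h2 := sq_norm_add_le_young (μ • (w - u)) (-(gradient (ℓ k) u - gradient (ℓ k) w))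
      (s := L / (2 * μ)) (by positivity)
    rw [norm_neg, norm_smul, Real.norm_of_nonneg hμ.le, inv_div] at h2
    refine h2.trans ?_
    have h3 := mul_le_mul_of_nonneg_left h1 (by positivity : 0 ≤ 1 + 2 * μ / L)
    have h4 : (1 + 2 * μ / L) * (2 * L * bregman ℓ k u w) = (L + 2 * μ) * (2 * bregman ℓ k u w) := by
      field_simp
    have h5 : (1 + L / (2 * μ)) * (μ * ‖w - u‖) ^ 2 = (L + 2 * μ) * (μ / 2 * ‖w - u‖ ^ 2) := by
      field_simp
      ring
    rw [h4] at h3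
    rw [h5]
    linarith

theorem norm_gradReg_sub_le (hμ : 0 < μ) (hdiff : ∀ k, Differentiable ℝ (ℓ k))
    (hsmooth : ∀ k, LipschitzWith L (gradient (ℓ k))) (k : Fin n)
    (u w : EuclideanSpace ℝ (Fin d)) :
    ‖gradReg ℓ μ k w - gradReg ℓ μ k u‖ ≤ (L + μ) * ‖w - u‖ := by
  have e1 : gradReg ℓ μ k w - gradReg ℓ μ k u
      = (gradient (ℓ k) w - gradient (ℓ k) u) + μ • (w - u) := by
    rw [gradReg_eq hdiff, gradReg_eq hdiff]; module
  rw [e1]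
  refine (norm_add_le _ _).trans ?_
  rw [norm_smul, Real.norm_of_nonneg hμ.le, add_mul]
  gcongr
  exact (hsmooth k).norm_sub_le _ _

/-- Regularized gradients are unbounded in general, but stationarity expresses `μ u` as minus an
average of loss gradients, so `‖μ u‖ ≤ G`. -/
theorem norm_gradReg_le_of_stationary (hlip : ∀ k, LipschitzWith G (ℓ k))
    (hdiff : ∀ k, Differentiable ℝ (ℓ k)) {p : Fin n → ℝ} (hp0 : ∀ k, 0 ≤ p k)
    (hp1 : ∑ k, p k = 1) {u : EuclideanSpace ℝ (Fin d)}
    (hu : ∑ k, p k • gradReg ℓ μ k u = 0) (k : Fin n) : ‖gradReg ℓ μ k u‖ ≤ 2 * G := by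
  have h1 : μ • u = -∑ k, p k • gradient (ℓ k) u := by
    simp only [gradReg_eq hdiff, smul_add, Finset.sum_add_distrib, ← Finset.sum_smul, hp1,
      one_smul] at hu
    exact eq_neg_of_add_eq_zero_right hu
  have h2 : ‖μ • u‖ ≤ G := by
    rw [h1, norm_neg]
    refine (norm_sum_le _ _).trans ?_
    calc ∑ k, ‖p k • gradient (ℓ k) u‖ ≤ ∑ k, p k * (G : ℝ) := by
          refine Finset.sum_le_sum fun k _ => ?_
          rw [norm_smul, Real.norm_of_nonneg (hp0 k)]
          exact mul_le_mul_of_nonneg_left (norm_gradient_le_of_lipschitz (hlip k) u) (hp0 k)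
      _ = G := by rw [← Finset.sum_mul, hp1, one_mul]
  rw [gradReg_eq hdiff]
  have h3 := norm_gradient_le_of_lipschitz (hlip k) u
  linarith [norm_add_le (gradient (ℓ k) u) (μ • u)]

/-- The `q`-weighted Bregman terms are an exact identity for the inner product; the `p`-weighted
part uses convexity at `u` and stationarity to cancel the regularizer's contribution there. -/
theorem le_inner_sum_smul_gradReg (hconv : ∀ k, ConvexOn ℝ Set.univ (ℓ k))
    (hdiff : ∀ k, Differentiable ℝ (ℓ k)) {p q : Fin n → ℝ} (hp0 : ∀ k, 0 ≤ p k)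
    (hp1 : ∑ k, p k = 1) (hq1 : ∑ k, q k = 1) {u : EuclideanSpace ℝ (Fin d)}
    (hu : ∑ k, p k • gradReg ℓ μ k u = 0) (w : EuclideanSpace ℝ (Fin d)) :
    ∑ k, (q k - p k) * (ℓ k w - ℓ k u) + μ * ‖w - u‖ ^ 2 + ∑ k, q k * bregman ℓ k u w
      ≤ inner ℝ (∑ k, q k • gradReg ℓ μ k w) (w - u) := by
  have hpu : ∑ k, p k * inner ℝ (gradient (ℓ k) u) (w - u) = -(μ * inner ℝ u (w - u)) := by
    have h := congrArg (fun v => inner ℝ v (w - u)) hu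
    simp only [gradReg_eq hdiff, sum_inner, real_inner_smul_left, inner_add_left, inner_zero_left,
      mul_add, Finset.sum_add_distrib, ← Finset.sum_mul, hp1, one_mul] at h
    linarith
  have hqw : inner ℝ (∑ k, q k • gradReg ℓ μ k w) (w - u)
      = ∑ k, q k * inner ℝ (gradient (ℓ k) w) (w - u) + μ * inner ℝ w (w - u) := by
    simp only [gradReg_eq hdiff, sum_inner, real_inner_smul_left, inner_add_left,
      mul_add, Finset.sum_add_distrib, ← Finset.sum_mul, hq1, one_mul]
  have hconvp : ∑ k, p k * inner ℝ (gradient (ℓ k) u) (w - u) ≤ ∑ k, p k * (ℓ k w - ℓ k u) := by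
    refine Finset.sum_le_sum fun k _ => mul_le_mul_of_nonneg_left ?_ (hp0 k)
    have := (hconv k).add_inner_gradient_le (hdiff k) u w
    linarith
  have hbreg : ∑ k, q k * bregman ℓ k u w
      = ∑ k, q k * inner ℝ (gradient (ℓ k) w) (w - u) - ∑ k, q k * (ℓ k w - ℓ k u) := by
    rw [← Finset.sum_sub_distrib]
    refine Finset.sum_congr rfl fun k _ => ?_
    unfold bregman
    rw [← neg_sub w u, inner_neg_right]
    ring
  have hsplit : ∑ k, (q k - p k) * (ℓ k w - ℓ k u)
      = ∑ k, q k * (ℓ k w - ℓ k u) - ∑ k, p k * (ℓ k w - ℓ k u) := by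
    simp only [sub_mul, Finset.sum_sub_distrib]
  have hsq : inner ℝ w (w - u) - inner ℝ u (w - u) = ‖w - u‖ ^ 2 := by
    rw [← inner_sub_left, real_inner_self_eq_norm_sq]
  rw [hqw, hbreg, hsplit, ← hsq]
  linarith

end RegularizedLosses

/-! ### Error of the weighted gradient table. -/

section GradientTable

variable {n d : ℕ} {ℓ : Fin n → EuclideanSpace ℝ (Fin d) → ℝ} {G L : ℝ≥0} {μ : ℝ}

/-- Squared error of the table of weighted gradients relative to the reference weights `p` and
reference point `u`. -/
noncomputable def gradTableError (ℓ : Fin n → EuclideanSpace ℝ (Fin d) → ℝ) (μ : ℝ)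
    (p : Fin n → ℝ) (u : EuclideanSpace ℝ (Fin d)) (ρ : Fin n → ℝ)
    (z : Fin n → EuclideanSpace ℝ (Fin d)) : ℝ :=
  n * ∑ k, ‖ρ k • gradReg ℓ μ k (z k) - p k • gradReg ℓ μ k u‖ ^ 2

theorem gradTableError_nonneg (p : Fin n → ℝ) (u : EuclideanSpace ℝ (Fin d)) (ρ : Fin n → ℝ)
    (z : Fin n → EuclideanSpace ℝ (Fin d)) : 0 ≤ gradTableError ℓ μ p u ρ z := by
  unfold gradTableError; positivity

theorem sum_gradTableError_update (p : Fin n → ℝ) (u w : EuclideanSpace ℝ (Fin d)) (ρ q : Fin n → ℝ)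
    (z : Fin n → EuclideanSpace ℝ (Fin d)) :
    ∑ i, gradTableError ℓ μ p u (Function.update ρ i (q i)) (Function.update z i w)
      = (n - 1) * gradTableError ℓ μ p u ρ z + gradTableError ℓ μ p u q fun _ => w := by
  have h := sum_sum_update
    (fun k (y : ℝ × EuclideanSpace ℝ (Fin d)) =>
      ‖y.1 • gradReg ℓ μ k y.2 - p k • gradReg ℓ μ k u‖ ^ 2)
    (fun k => (ρ k, z k)) (fun i => (q i, w))
  have h2 : ∀ i k, Function.update (fun k => (ρ k, z k)) i (q i, w) k
      = (Function.update ρ i (q i) k, Function.update z i w k) := by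
    intro i k
    by_cases hk : k = i
    · subst hk; simp
    · simp [Function.update_of_ne hk]
  simp only [h2] at h
  unfold gradTableError
  rw [← Finset.mul_sum, h]
  ring

/-- Separate the change of point from the change of weight: `q∇r(w) - p∇r(u) = q(∇r(w) - ∇r(u)) + (q
- p)∇r(u)`. -/
theorem gradTableError_le {p q : Fin n → ℝ} {u w : EuclideanSpace ℝ (Fin d)} {s : ℝ}
    (hq0 : ∀ k, 0 ≤ q k) (hqs : ∀ k, q k ≤ s) (hbd : ∀ k, ‖gradReg ℓ μ k u‖ ≤ 2 * G) :
    gradTableError ℓ μ p u q (fun _ => w)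
      ≤ 2 * (n * s) * ∑ k, q k * ‖gradReg ℓ μ k w - gradReg ℓ μ k u‖ ^ 2
        + 8 * (n * G ^ 2 * ∑ k, (q k - p k) ^ 2) := by
  have h : ∀ k, ‖q k • gradReg ℓ μ k w - p k • gradReg ℓ μ k u‖ ^ 2
      ≤ 2 * s * (q k * ‖gradReg ℓ μ k w - gradReg ℓ μ k u‖ ^ 2) + 8 * G ^ 2 * (q k - p k) ^ 2 := by
    intro k
    have e : q k • gradReg ℓ μ k w - p k • gradReg ℓ μ k u
        = q k • (gradReg ℓ μ k w - gradReg ℓ μ k u) + (q k - p k) • gradReg ℓ μ k u := by module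
    rw [e]
    refine (sq_norm_add_le _ _).trans ?_
    rw [norm_smul, norm_smul, mul_pow, mul_pow, Real.norm_eq_abs, Real.norm_eq_abs, sq_abs, sq_abs]
    have h1 : ‖gradReg ℓ μ k u‖ ^ 2 ≤ (2 * G) ^ 2 := pow_le_pow_left₀ (norm_nonneg _) (hbd k) 2
    have h2 := mul_le_mul_of_nonneg_left h1 (sq_nonneg (q k - p k))
    have h3 := mul_le_mul_of_nonneg_right (hqs k)
      (mul_nonneg (hq0 k) (sq_nonneg ‖gradReg ℓ μ k w - gradReg ℓ μ k u‖))
    linarith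
  have h2 := Finset.sum_le_sum fun k (_ : k ∈ Finset.univ) => h k
  rw [Finset.sum_add_distrib, ← Finset.mul_sum, ← Finset.mul_sum] at h2
  have h3 := mul_le_mul_of_nonneg_left h2 (Nat.cast_nonneg (α := ℝ) n)
  unfold gradTableError
  linarith

/-- Bound of the gradient table error at the current weights by the Bregman divergences. -/
theorem gradTableError_le_bregman (hμ : 0 < μ) (hconv : ∀ k, ConvexOn ℝ Set.univ (ℓ k))
    (hdiff : ∀ k, Differentiable ℝ (ℓ k)) (hsmooth : ∀ k, LipschitzWith L (gradient (ℓ k)))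
    {p q : Fin n → ℝ} {u w : EuclideanSpace ℝ (Fin d)} {s : ℝ} (hs : 0 ≤ s)
    (hq0 : ∀ k, 0 ≤ q k) (hqs : ∀ k, q k ≤ s) (hq1 : ∑ k, q k = 1)
    (hbd : ∀ k, ‖gradReg ℓ μ k u‖ ≤ 2 * G) :
    gradTableError ℓ μ p u q (fun _ => w)
      ≤ 2 * (n * s) * ((L + 2 * μ) * (2 * ∑ k, q k * bregman ℓ k u w + μ / 2 * ‖w - u‖ ^ 2))
        + 8 * (n * G ^ 2 * ∑ k, (q k - p k) ^ 2) := by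
  refine (gradTableError_le hq0 hqs hbd).trans ?_
  gcongr
  calc ∑ k, q k * ‖gradReg ℓ μ k w - gradReg ℓ μ k u‖ ^ 2
      ≤ ∑ k, q k * ((L + 2 * μ) * (2 * bregman ℓ k u w + μ / 2 * ‖w - u‖ ^ 2)) :=
        Finset.sum_le_sum fun k _ =>
          mul_le_mul_of_nonneg_left (sq_norm_gradReg_sub_le hμ hconv hdiff hsmooth k u w) (hq0 k)
    _ = (L + 2 * μ) * (2 * ∑ k, q k * bregman ℓ k u w
          + (∑ k, q k) * (μ / 2 * ‖w - u‖ ^ 2)) := by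
        rw [Finset.mul_sum, Finset.sum_mul, ← Finset.sum_add_distrib, Finset.mul_sum]
        exact Finset.sum_congr rfl fun k _ => by ring
    _ = _ := by rw [hq1, one_mul]

theorem gradTableError_le_sq_dist (hμ : 0 < μ)
    (hdiff : ∀ k, Differentiable ℝ (ℓ k)) (hsmooth : ∀ k, LipschitzWith L (gradient (ℓ k)))
    {p q : Fin n → ℝ} {u w : EuclideanSpace ℝ (Fin d)} {s : ℝ} (hs : 0 ≤ s)
    (hq0 : ∀ k, 0 ≤ q k) (hqs : ∀ k, q k ≤ s) (hq1 : ∑ k, q k = 1)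
    (hbd : ∀ k, ‖gradReg ℓ μ k u‖ ≤ 2 * G) :
    gradTableError ℓ μ p u q (fun _ => w)
      ≤ 2 * (n * s) * ((L + μ) ^ 2 * ‖w - u‖ ^ 2) + 8 * (n * G ^ 2 * ∑ k, (q k - p k) ^ 2) := by
  refine (gradTableError_le hq0 hqs hbd).trans ?_
  gcongr
  calc ∑ k, q k * ‖gradReg ℓ μ k w - gradReg ℓ μ k u‖ ^ 2
      ≤ ∑ k, q k * ((L + μ) ^ 2 * ‖w - u‖ ^ 2) := by
        refine Finset.sum_le_sum fun k _ => mul_le_mul_of_nonneg_left ?_ (hq0 k)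
        rw [← mul_pow]
        exact pow_le_pow_left₀ (norm_nonneg _) (norm_gradReg_sub_le hμ hdiff hsmooth k u w) 2
    _ = _ := by rw [← Finset.sum_mul, hq1, one_mul]

end GradientTable

/-! ### One iteration, summed over the sampled indices. -/

section OneStep

variable {n d : ℕ} {ℓ : Fin n → EuclideanSpace ℝ (Fin d) → ℝ} {σ : Fin n → ℝ} {f : ℝ → ℝ}
  {ν μ η : ℝ} {p : Fin n → ℝ} {u : EuclideanSpace ℝ (Fin d)}

theorem sum_prospect_v (s : ProspectState n d) :
    ∑ i, s.v ℓ σ f ν μ i = (n : ℝ) • ∑ k, s.q ℓ σ f ν k • gradReg ℓ μ k s.w := by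
  simp only [ProspectState.v, Finset.sum_sub_distrib, mul_smul, ← Finset.smul_sum,
    Finset.sum_const, Finset.card_univ, Fintype.card_fin, ← Nat.cast_smul_eq_nsmul ℝ]
  module

/-- Subtracting `n p_i ∇r_i(u)` from both sampled gradients leaves the direction unchanged and, by
stationarity, leaves the table mean `m` unchanged. The control variate is then centred by its own
mean, which cannot increase its second moment. -/
theorem sum_sq_norm_prospect_v_le (hu : ∑ k, p k • gradReg ℓ μ k u = 0) (s : ProspectState n d) :
    ∑ i, ‖s.v ℓ σ f ν μ i‖ ^ 2
      ≤ n * (2 * gradTableError ℓ μ p u (s.q ℓ σ f ν) (fun _ => s.w)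
          + 2 * gradTableError ℓ μ p u s.ρ s.z) := by
  let X : Fin n → EuclideanSpace ℝ (Fin d) := fun i =>
    (n : ℝ) • (s.q ℓ σ f ν i • gradReg ℓ μ i s.w - p i • gradReg ℓ μ i u)
  let Y : Fin n → EuclideanSpace ℝ (Fin d) := fun i =>
    (n : ℝ) • (s.ρ i • gradReg ℓ μ i (s.z i) - p i • gradReg ℓ μ i u)
  let m := ∑ k, s.ρ k • gradReg ℓ μ k (s.z k)
  have hm : ∑ k, Y k = (n : ℝ) • m := by
    simp only [Y, ← Finset.smul_sum, Finset.sum_sub_distrib, hu, sub_zero, m]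
  have hv : ∀ i, s.v ℓ σ f ν μ i = X i - (Y i - m) := by
    intro i
    simp only [ProspectState.v, X, Y, m]
    module
  have h1 : ∀ (c : Fin n → EuclideanSpace ℝ (Fin d)),
      ∑ i, ‖(n : ℝ) • c i‖ ^ 2 = n * (n * ∑ i, ‖c i‖ ^ 2) := by
    intro c
    rw [Finset.mul_sum, Finset.mul_sum]
    refine Finset.sum_congr rfl fun i _ => ?_
    rw [norm_smul, mul_pow, Real.norm_natCast]
    ring
  calc ∑ i, ‖s.v ℓ σ f ν μ i‖ ^ 2 ≤ ∑ i, (2 * ‖X i‖ ^ 2 + 2 * ‖Y i - m‖ ^ 2) :=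
        Finset.sum_le_sum fun i _ => by rw [hv]; exact sq_norm_sub_le _ _
    _ = 2 * ∑ i, ‖X i‖ ^ 2 + 2 * ∑ i, ‖Y i - m‖ ^ 2 := by
        rw [Finset.sum_add_distrib, ← Finset.mul_sum, ← Finset.mul_sum]
    _ ≤ 2 * ∑ i, ‖X i‖ ^ 2 + 2 * ∑ i, ‖Y i‖ ^ 2 := by
        gcongr 2 * ∑ i, ‖X i‖ ^ 2 + 2 * ?_
        exact sum_sq_norm_sub_mean_le Y m hm
    _ = _ := by
        simp only [X, Y, h1, gradTableError]
        ring

theorem sum_sq_norm_step_sub (s : ProspectState n d) (u : EuclideanSpace ℝ (Fin d)) :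
    ∑ i, ‖s.w - η • s.v ℓ σ f ν μ i - u‖ ^ 2
      = n * (‖s.w - u‖ ^ 2
          - 2 * η * inner ℝ (∑ k, s.q ℓ σ f ν k • gradReg ℓ μ k s.w) (s.w - u))
        + η ^ 2 * ∑ i, ‖s.v ℓ σ f ν μ i‖ ^ 2 := by
  have h : ∀ i, ‖s.w - η • s.v ℓ σ f ν μ i - u‖ ^ 2 = ‖s.w - u‖ ^ 2
      - 2 * η * inner ℝ (s.v ℓ σ f ν μ i) (s.w - u) + η ^ 2 * ‖s.v ℓ σ f ν μ i‖ ^ 2 := by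
    intro i
    rw [sub_right_comm, norm_sub_sq_real, real_inner_smul_right, norm_smul, mul_pow,
      Real.norm_eq_abs, sq_abs, real_inner_comm]
    ring
  simp only [h, Finset.sum_add_distrib, Finset.sum_sub_distrib, ← Finset.mul_sum, ← sum_inner,
    sum_prospect_v, real_inner_smul_left, Finset.sum_const, Finset.card_univ, Fintype.card_fin,
    nsmul_eq_mul]
  ring

/-- The refreshed entry is the old iterate, so it contributes only through the step `η v`. Young's
parameter `1/(2n)` gives up half of the `1/n` contraction from refreshing, which makes the noise
factor `1 + 2n`. -/
theorem sum_sum_sq_norm_step_sub_table_le (hn : 0 < n) (s : ProspectState n d) :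
    ∑ i, ∑ j, ∑ k, ‖s.w - η • s.v ℓ σ f ν μ i - Function.update s.ζ j s.w k‖ ^ 2
      ≤ (n + 1 / 2) * (n - 1) * ∑ k, ‖s.w - s.ζ k‖ ^ 2
        + n ^ 2 * (1 + 2 * n) * η ^ 2 * ∑ i, ‖s.v ℓ σ f ν μ i‖ ^ 2 := by
  have hn' : (0 : ℝ) < n := Nat.cast_pos.2 hn
  have h1 : ∀ i (y : EuclideanSpace ℝ (Fin d)), ‖s.w - η • s.v ℓ σ f ν μ i - y‖ ^ 2
      ≤ (1 + 1 / (2 * n)) * ‖s.w - y‖ ^ 2 + (1 + 2 * n) * (η ^ 2 * ‖s.v ℓ σ f ν μ i‖ ^ 2) := by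
    intro i y
    have h := sq_norm_add_le_young (s.w - y) (-(η • s.v ℓ σ f ν μ i)) (s := 1 / (2 * n))
      (by positivity)
    rw [norm_neg, norm_smul, mul_pow, Real.norm_eq_abs, sq_abs, inv_div, div_one] at h
    rwa [show s.w - η • s.v ℓ σ f ν μ i - y = s.w - y + -(η • s.v ℓ σ f ν μ i) by abel]
  have h2 := sum_sum_update (fun _ (y : EuclideanSpace ℝ (Fin d)) => ‖s.w - y‖ ^ 2) s.ζ
    (fun _ => s.w)
  simp only [sub_self, norm_zero, ne_eq, OfNat.ofNat_ne_zero, not_false_eq_true, zero_pow,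
    Finset.sum_const_zero, add_zero] at h2
  calc _ ≤ ∑ i, ∑ j, ∑ k, ((1 + 1 / (2 * n)) * ‖s.w - Function.update s.ζ j s.w k‖ ^ 2
          + (1 + 2 * n) * (η ^ 2 * ‖s.v ℓ σ f ν μ i‖ ^ 2)) :=
        Finset.sum_le_sum fun i _ => Finset.sum_le_sum fun j _ => Finset.sum_le_sum fun k _ =>
          h1 i _
    _ = _ := by
        simp only [Finset.sum_add_distrib, ← Finset.mul_sum, h2, Finset.sum_const,
          Finset.card_univ, Fintype.card_fin, nsmul_eq_mul]
        field_simp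

theorem sum_sum_sq_norm_table_sub (s : ProspectState n d) (u : EuclideanSpace ℝ (Fin d)) :
    ∑ j, ∑ k, ‖Function.update s.ζ j s.w k - u‖ ^ 2
      = (n - 1) * ∑ k, ‖s.ζ k - u‖ ^ 2 + n * ‖s.w - u‖ ^ 2 := by
  rw [sum_sum_update (fun _ (y : EuclideanSpace ℝ (Fin d)) => ‖y - u‖ ^ 2) s.ζ (fun _ => s.w)]
  simp

end OneStep

/-! ### From one-step averages to expectations. -/

section Sampling

variable {n d : ℕ} {ℓ : Fin n → EuclideanSpace ℝ (Fin d) → ℝ} {σ : Fin n → ℝ} {f : ℝ → ℝ}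
  {ν μ η : ℝ}

theorem prospectState_congr (w₀ : EuclideanSpace ℝ (Fin d)) {i j i' j' : ℕ → Fin n} {t : ℕ}
    (hi : ∀ s < t, i s = i' s) (hj : ∀ s < t, j s = j' s) :
    prospectState ℓ σ f ν μ η w₀ i j t = prospectState ℓ σ f ν μ η w₀ i' j' t := by
  induction t with
  | zero => rfl
  | succ t ih =>
    simp only [prospectState]
    rw [ih (fun s hs => hi s (hs.trans t.lt_succ_self)) (fun s hs => hj s (hs.trans t.lt_succ_self)),
      hi t t.lt_succ_self, hj t t.lt_succ_self]

variable [NeZero n] {Ω : Type*} [MeasurableSpace Ω] {P : Measure Ω} [IsProbabilityMeasure P]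
  {i j : ℕ → Ω → Fin n}

/-- Conditional expectation over the fresh pair of indices: a bounded one-step average growth of
`V` transfers to expectations. -/
theorem integral_prospectState_succ_le (hij : IsUniformSampling P i j)
    (V : ProspectState n d → ℝ) {c : ℝ}
    (hV : ∀ s, ∑ a, ∑ b, V (prospectStep ℓ σ f ν μ η a b s) ≤ (n : ℝ) ^ 2 * (c * V s))
    (w₀ : EuclideanSpace ℝ (Fin d)) (t : ℕ) :
    ∫ ω, V (prospectState ℓ σ f ν μ η w₀ (fun s => i s ω) (fun s => j s ω) (t + 1)) ∂P
      ≤ c * ∫ ω, V (prospectState ℓ σ f ν μ η w₀ (fun s => i s ω) (fun s => j s ω) t) ∂P := by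
  let X : ℕ → Ω → Fin n × Fin n := fun s ω => (i s ω, j s ω)
  have hX : ∀ s, Measurable (X s) := fun s => (hij.measurable_fst s).prodMk (hij.measurable_snd s)
  let H : Ω → Finset.range t → Fin n × Fin n := fun ω s => X s ω
  have hH : Measurable H := measurable_pi_lambda _ fun s => hX s
  -- The state at time `t` is a function of the first `t` pairs only; the filler `0` at later times
  -- is never read. The history space is finite, so measurability and integrability are automatic.
  let st : (Finset.range t → Fin n × Fin n) → ProspectState n d := fun h =>
    prospectState ℓ σ f ν μ η w₀
      (fun s => if hs : s ∈ Finset.range t then (h ⟨s, hs⟩).1 else 0)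
      (fun s => if hs : s ∈ Finset.range t then (h ⟨s, hs⟩).2 else 0) t
  have hst : ∀ ω, prospectState ℓ σ f ν μ η w₀ (fun s => i s ω) (fun s => j s ω) t = st (H ω) := by
    intro ω
    refine prospectState_congr w₀ (fun s hs => ?_) (fun s hs => ?_) <;>
      simp [H, X, hs]
  have hindep : IndepFun H (X t) P := by
    have h := hij.indep.indepFun_finset (Finset.range t) {t} (by simp) hX
    exact h.comp measurable_id (measurable_pi_apply ⟨t, Finset.mem_singleton_self t⟩)
  have hmap := (indepFun_iff_map_prod_eq_prod_map_map hH.aemeasurable (hX t).aemeasurable).1 hindep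
  have hPH : IsProbabilityMeasure (P.map H) := Measure.isProbabilityMeasure_map hH.aemeasurable
  have hlaw : P.map (X t) = (PMF.uniformOfFintype (Fin n × Fin n)).toMeasure := hij.law t
  let Ψ : (Finset.range t → Fin n × Fin n) × (Fin n × Fin n) → ℝ := fun x =>
    V (prospectStep ℓ σ f ν μ η x.2.1 x.2.2 (st x.1))
  have hn : (0 : ℝ) < n := Nat.cast_pos.2 (NeZero.pos n)
  calc ∫ ω, V (prospectState ℓ σ f ν μ η w₀ (fun s => i s ω) (fun s => j s ω) (t + 1)) ∂P
      = ∫ ω, Ψ (H ω, X t ω) ∂P := by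
        simp only [prospectState, hst, Ψ, X]
    _ = ∫ x, Ψ x ∂(P.map fun ω => (H ω, X t ω)) :=
        (integral_map (hH.prodMk (hX t)).aemeasurable
          (measurable_of_finite Ψ).aestronglyMeasurable).symm
    _ = ∫ h, ∫ x, Ψ (h, x) ∂(PMF.uniformOfFintype (Fin n × Fin n)).toMeasure ∂(P.map H) := by
        rw [hmap, hlaw, integral_prod _ Integrable.of_finite]
    _ ≤ ∫ h, c * V (st h) ∂(P.map H) := by
        refine integral_mono Integrable.of_finite Integrable.of_finite fun h => ?_
        beta_reduce
        rw [PMF.integral_eq_sum]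
        simp only [PMF.uniformOfFintype_apply, Fintype.card_prod, Fintype.card_fin,
          ENNReal.toReal_inv, ENNReal.toReal_natCast, smul_eq_mul, ← Finset.mul_sum]
        rw [Fintype.sum_prod_type, Nat.cast_mul, inv_mul_le_iff₀ (by positivity), ← pow_two]
        exact hV (st h)
    _ = c * ∫ ω, V (st (H ω)) ∂P := by
        rw [integral_const_mul, integral_map hH.aemeasurable
          (measurable_of_finite fun h => V (st h)).aestronglyMeasurable]
    _ = _ := by simp only [hst]

theorem integral_prospectState_le (hij : IsUniformSampling P i j)
    (V : ProspectState n d → ℝ) {c : ℝ} (hc : 0 ≤ c)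
    (hV : ∀ s, ∑ a, ∑ b, V (prospectStep ℓ σ f ν μ η a b s) ≤ (n : ℝ) ^ 2 * (c * V s))
    (w₀ : EuclideanSpace ℝ (Fin d)) (t : ℕ) :
    ∫ ω, V (prospectState ℓ σ f ν μ η w₀ (fun s => i s ω) (fun s => j s ω) t) ∂P
      ≤ c ^ t * V (prospectInit ℓ σ f ν w₀) := by
  induction t with
  | zero => simp [prospectState]
  | succ t ih =>
    refine (integral_prospectState_succ_le hij V hV w₀ t).trans ?_
    rw [pow_succ', mul_assoc]
    exact mul_le_mul_of_nonneg_left ih hc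

theorem integrable_comp_prospectState (hij : IsUniformSampling P i j) (V : ProspectState n d → ℝ)
    (w₀ : EuclideanSpace ℝ (Fin d)) (t : ℕ) :
    Integrable (fun ω => V (prospectState ℓ σ f ν μ η w₀ (fun s => i s ω) (fun s => j s ω) t)) P := by
  let H : Ω → Finset.range t → Fin n × Fin n := fun ω s => (i s ω, j s ω)
  have hH : Measurable H :=
    measurable_pi_lambda _ fun s => (hij.measurable_fst s).prodMk (hij.measurable_snd s)
  have hPH : IsProbabilityMeasure (P.map H) := Measure.isProbabilityMeasure_map hH.aemeasurable
  let W : (Finset.range t → Fin n × Fin n) → ℝ := fun h => V (prospectState ℓ σ f ν μ η w₀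
      (fun s => if hs : s ∈ Finset.range t then (h ⟨s, hs⟩).1 else 0)
      (fun s => if hs : s ∈ Finset.range t then (h ⟨s, hs⟩).2 else 0) t)
  have h := (Integrable.of_finite (μ := P.map H) (f := W)).comp_measurable hH
  convert h using 2 with ω
  simp only [Function.comp, W]
  congr 1
  refine prospectState_congr w₀ (fun s hs => ?_) (fun s hs => ?_) <;> simp [H, hs]

/-- A Lyapunov function that dominates the squared distance and contracts on average by `1 - 1/τ`
yields linear convergence. -/
theorem expectedSqDist_le_of_lyapunov (hij : IsUniformSampling P i j)
    (V : ProspectState n d → ℝ) {r τ C : ℝ} {u : EuclideanSpace ℝ (Fin d)}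
    (hdom : ∀ s, ‖s.w - u‖ ^ 2 ≤ V s) (hr : r ≤ 1) (hτ : τ⁻¹ ≤ r)
    (hV : ∀ s, ∑ a, ∑ b, V (prospectStep ℓ σ f ν μ η a b s) ≤ (n : ℝ) ^ 2 * ((1 - r) * V s))
    {w₀ : EuclideanSpace ℝ (Fin d)} (h0 : V (prospectInit ℓ σ f ν w₀) ≤ C * ‖w₀ - u‖ ^ 2) (t : ℕ) :
    expectedSqDist P i j ℓ σ f ν μ η w₀ u t
      ≤ C * Real.exp (-(t : ℝ) / τ) * ‖w₀ - u‖ ^ 2 := by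
  have h1 : expectedSqDist P i j ℓ σ f ν μ η w₀ u t
      ≤ ∫ ω, V (prospectState ℓ σ f ν μ η w₀ (fun s => i s ω) (fun s => j s ω) t) ∂P :=
    integral_mono (integrable_comp_prospectState hij (fun s => ‖s.w - u‖ ^ 2) w₀ t)
      (integrable_comp_prospectState hij V w₀ t) fun ω => hdom _
  have h2 := integral_prospectState_le hij V (sub_nonneg.2 hr) hV w₀ t
  have h3 : (1 - r) ^ t ≤ Real.exp (-(t : ℝ) / τ) := by
    have h4 : 1 - r ≤ Real.exp (-τ⁻¹) := by
      have := Real.add_one_le_exp (-τ⁻¹)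
      linarith
    calc (1 - r) ^ t ≤ Real.exp (-τ⁻¹) ^ t := pow_le_pow_left₀ (sub_nonneg.2 hr) h4 t
      _ = Real.exp (-(t : ℝ) / τ) := by
        rw [← Real.exp_nat_mul]
        congr 1
        ring
  have hV0 : 0 ≤ V (prospectInit ℓ σ f ν w₀) := (sq_nonneg _).trans (hdom _)
  calc _ ≤ (1 - r) ^ t * V (prospectInit ℓ σ f ν w₀) := h1.trans h2
    _ ≤ Real.exp (-(t : ℝ) / τ) * (C * ‖w₀ - u‖ ^ 2) :=
        mul_le_mul h3 h0 hV0 (Real.exp_pos _).le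
    _ = _ := by ring

end Sampling

/-! ### The Lyapunov function and its one-step average. -/

section Lyapunov

variable {n d : ℕ} {ℓ : Fin n → EuclideanSpace ℝ (Fin d) → ℝ} {σ : Fin n → ℝ} {f : ℝ → ℝ}
  {ν μ η : ℝ} {p : Fin n → ℝ} {u : EuclideanSpace ℝ (Fin d)}

/-- Squared distance to `u` plus weighted errors of the gradient table and of the points of the
loss table, the latter relative to both `u` and the current iterate. -/
noncomputable def lyapunov (ℓ : Fin n → EuclideanSpace ℝ (Fin d) → ℝ) (μ : ℝ) (p : Fin n → ℝ)
    (u : EuclideanSpace ℝ (Fin d)) (c₁ c₂ c₃ : ℝ) (s : ProspectState n d) : ℝ :=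
  ‖s.w - u‖ ^ 2 + c₁ * gradTableError ℓ μ p u s.ρ s.z + c₂ * ∑ k, ‖s.ζ k - u‖ ^ 2
    + c₃ * ∑ k, ‖s.w - s.ζ k‖ ^ 2

theorem sq_norm_sub_le_lyapunov {c₁ c₂ c₃ : ℝ} (h₁ : 0 ≤ c₁) (h₂ : 0 ≤ c₂) (h₃ : 0 ≤ c₃)
    (s : ProspectState n d) : ‖s.w - u‖ ^ 2 ≤ lyapunov ℓ μ p u c₁ c₂ c₃ s := by
  have h1 := mul_nonneg h₁ (gradTableError_nonneg (ℓ := ℓ) (μ := μ) p u s.ρ s.z)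
  have h2 : 0 ≤ c₂ * ∑ k, ‖s.ζ k - u‖ ^ 2 := by positivity
  have h3 : 0 ≤ c₃ * ∑ k, ‖s.w - s.ζ k‖ ^ 2 := by positivity
  unfold lyapunov
  linarith

/-- Each table contracts because one uniformly chosen entry is refreshed, and the second moment of
the direction enters through the distance and the staleness. Naming the quantities by scalars
reduces contraction to real inequalities. -/
theorem sum_sum_lyapunov_step_le (hn : 0 < n) (hu : ∑ k, p k • gradReg ℓ μ k u = 0)
    {c₁ c₂ c₃ : ℝ} (h₃ : 0 ≤ c₃) (s : ProspectState n d)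
    {e H A S T U : ℝ} (he : ‖s.w - u‖ ^ 2 = e)
    (hH : inner ℝ (∑ k, s.q ℓ σ f ν k • gradReg ℓ μ k s.w) (s.w - u) = H)
    (hA : gradTableError ℓ μ p u (s.q ℓ σ f ν) (fun _ => s.w) = A)
    (hS : gradTableError ℓ μ p u s.ρ s.z = S) (hT : ∑ k, ‖s.ζ k - u‖ ^ 2 = T)
    (hU : ∑ k, ‖s.w - s.ζ k‖ ^ 2 = U) :
    ∑ a, ∑ b, lyapunov ℓ μ p u c₁ c₂ c₃ (prospectStep ℓ σ f ν μ η a b s)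
      ≤ (n : ℝ) ^ 2 * (e - 2 * η * H + η ^ 2 * (2 * A + 2 * S) + c₁ * ((1 - 1 / n) * S + A / n)
          + c₂ * ((1 - 1 / n) * T + e)
          + c₃ * ((1 - 1 / (2 * n)) * U + n * (1 + 2 * n) * η ^ 2 * (2 * A + 2 * S))) := by
  have hn' : (0 : ℝ) < n := Nat.cast_pos.2 hn
  have hU0 : 0 ≤ U := hU ▸ Finset.sum_nonneg fun k _ => sq_nonneg _
  have h1 := sum_sq_norm_step_sub (ℓ := ℓ) (σ := σ) (f := f) (ν := ν) (μ := μ) (η := η) s u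
  have h2 := sum_gradTableError_update (ℓ := ℓ) (μ := μ) p u s.w s.ρ (s.q ℓ σ f ν) s.z
  have h3 := sum_sum_sq_norm_table_sub s u
  have h4 := sum_sum_sq_norm_step_sub_table_le (ℓ := ℓ) (σ := σ) (f := f) (ν := ν) (μ := μ)
    (η := η) hn s
  have h5 := sum_sq_norm_prospect_v_le (ℓ := ℓ) (σ := σ) (f := f) (ν := ν) hu s
  rw [he, hH] at h1
  rw [hS, hA] at h2
  rw [hT, he] at h3
  rw [hU] at h4
  rw [hS, hA] at h5
  set W := ∑ i, ‖s.v ℓ σ f ν μ i‖ ^ 2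
  have hsum : ∑ a, ∑ b, lyapunov ℓ μ p u c₁ c₂ c₃ (prospectStep ℓ σ f ν μ η a b s)
      = n * ∑ a, ‖s.w - η • s.v ℓ σ f ν μ a - u‖ ^ 2
        + c₁ * (n * ∑ a, gradTableError ℓ μ p u (Function.update s.ρ a (s.q ℓ σ f ν a))
            (Function.update s.z a s.w))
        + c₂ * (n * ∑ b, ∑ k, ‖Function.update s.ζ b s.w k - u‖ ^ 2)
        + c₃ * ∑ a, ∑ b, ∑ k,
            ‖s.w - η • s.v ℓ σ f ν μ a - Function.update s.ζ b s.w k‖ ^ 2 := by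
    simp only [lyapunov, prospectStep, Finset.sum_add_distrib, ← Finset.mul_sum, Finset.sum_const,
      Finset.card_univ, Fintype.card_fin, nsmul_eq_mul]
  rw [hsum, h1, h2, h3]
  have h6 := mul_le_mul_of_nonneg_left h4 h₃
  have h7 : (n * η ^ 2 + c₃ * (n ^ 2 * (1 + 2 * n) * η ^ 2)) * W
      ≤ (n * η ^ 2 + c₃ * (n ^ 2 * (1 + 2 * n) * η ^ 2)) * (n * (2 * A + 2 * S)) :=
    mul_le_mul_of_nonneg_left h5 (by positivity)
  have h8 : (n : ℝ) ^ 2 * (e - 2 * η * H + η ^ 2 * (2 * A + 2 * S)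
        + c₁ * ((1 - 1 / n) * S + A / n) + c₂ * ((1 - 1 / n) * T + e)
        + c₃ * ((1 - 1 / (2 * n)) * U + n * (1 + 2 * n) * η ^ 2 * (2 * A + 2 * S)))
      = n ^ 2 * (e - 2 * η * H) + c₁ * (n * ((n - 1) * S + A)) + c₂ * (n * ((n - 1) * T + n * e))
        + c₃ * ((n ^ 2 - n / 2) * U)
        + (n * η ^ 2 + c₃ * (n ^ 2 * (1 + 2 * n) * η ^ 2)) * (n * (2 * A + 2 * S)) := by
    field_simp
    ring
  have h9 : c₃ * ((n + 1 / 2) * (n - 1) * U) ≤ c₃ * ((n ^ 2 - n / 2) * U) := by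
    refine mul_le_mul_of_nonneg_left (mul_le_mul_of_nonneg_right ?_ hU0) h₃
    linarith
  rw [h8]
  linarith

end Lyapunov

/-! ### Contraction as inequalities between real numbers. -/

section ScalarBounds

/-- Scalar contraction estimate for the Lyapunov function used for an arbitrary shift cost. -/
theorem contraction_of_small_step {n η μ δ K e A S U P N H ω : ℝ} (hn : 1 ≤ n) (hη : 0 < η)
    (hμ : 0 < μ) (hδ : 0 ≤ δ) (hK : 2 ≤ K) (he : 0 ≤ e) (hA0 : 0 ≤ A) (hS : 0 ≤ S) (hU : 0 ≤ U)
    (hP : 0 ≤ P) (hN : 0 ≤ N) (hω : ω = 1 + (1 + 2 * n) * (n * (4 * δ * (η * μ))))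
    (hstep : 96 * (n * (η * μ)) * (8 * δ + K) ≤ 1)
    (hH : μ * e + P + N / 2 - δ * μ / n * U / 2 ≤ H)
    (hA : A ≤ 2 * (μ * K) * (2 * P + μ / 2 * e) + 8 * (δ * μ * N)) :
    ω ≤ 2 * n ∧
    e - 2 * η * H + η ^ 2 * (2 * A + 2 * S) + 4 * n * ω * η ^ 2 * ((1 - 1 / n) * S + A / n)
        + 4 * δ * (η * μ) * ((1 - 1 / (2 * n)) * U
          + n * (1 + 2 * n) * η ^ 2 * (2 * A + 2 * S))
      ≤ (1 - η * μ / 2) * (e + 4 * n * ω * η ^ 2 * S + 4 * δ * (η * μ) * U) := by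
  have hγ : 0 < η * μ := mul_pos hη hμ
  have hn0 : 0 < n := by linarith
  have hnγ : 0 < n * (η * μ) := mul_pos hn0 hγ
  have hγδ : 0 ≤ n * (η * μ) * δ := mul_nonneg hnγ.le hδ
  have hγK : 0 ≤ n * (η * μ) * K := mul_nonneg hnγ.le (by linarith)
  have b1 : 768 * (n * (η * μ) * δ) ≤ 1 := by linarith
  have b2 : 96 * (n * (η * μ) * K) ≤ 1 := by linarith
  have b3 : 192 * (n * (η * μ)) ≤ 1 := by nlinarith
  have hω2 : ω ≤ 2 * n := by
    rw [hω]
    nlinarith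
  have hω0 : 0 ≤ ω := by rw [hω]; positivity
  refine ⟨hω2, ?_⟩
  -- The noise from the current gradients must fit inside the gain `2ηH`, that is, inside fractions
  -- of its `P`, `e` and `N` terms. This fixes the constants 96 and 768 in the step condition.
  have hAb : 6 * ω * η ^ 2 * A ≤ η * (P / 2 + μ * e / 8 + N / 8) := by
    have h1 : 6 * ω * η ^ 2 * A ≤ 12 * n * η ^ 2 * A := by
      have : 0 ≤ η ^ 2 * A := by positivity
      nlinarith
    have h2 : 12 * n * η ^ 2 * A
        ≤ 12 * n * η ^ 2 * (2 * (μ * K) * (2 * P + μ / 2 * e) + 8 * (δ * μ * N)) :=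
      mul_le_mul_of_nonneg_left hA (by positivity)
    have h3 : 12 * n * η ^ 2 * (2 * (μ * K) * (2 * P + μ / 2 * e) + 8 * (δ * μ * N))
        = 96 * (n * (η * μ) * K) * (η * (P / 2 + μ * e / 8))
          + 768 * (n * (η * μ) * δ) * (η * (N / 8)) := by ring
    have h4 : 96 * (n * (η * μ) * K) * (η * (P / 2 + μ * e / 8))
        ≤ 1 * (η * (P / 2 + μ * e / 8)) := mul_le_mul_of_nonneg_right b2 (by positivity)
    have h5 : 768 * (n * (η * μ) * δ) * (η * (N / 8)) ≤ 1 * (η * (N / 8)) :=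
      mul_le_mul_of_nonneg_right b1 (by positivity)
    linarith
  have hHb := mul_le_mul_of_nonneg_left hH hη.le
  -- `ω` is chosen so that `1 + n(1 + 2n) · 4δημ = ω`: the noise from the distance and the staleness
  -- merges, and the weight `4nωη²` lets refreshing the gradient table absorb its share.
  have hL : e - 2 * η * H + η ^ 2 * (2 * A + 2 * S)
        + 4 * n * ω * η ^ 2 * ((1 - 1 / n) * S + A / n)
        + 4 * δ * (η * μ) * ((1 - 1 / (2 * n)) * U
          + n * (1 + 2 * n) * η ^ 2 * (2 * A + 2 * S))
      = e - 2 * (η * H) + 6 * ω * η ^ 2 * A + (4 * n - 2) * ω * η ^ 2 * S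
        + (4 * δ * (η * μ) - 2 * δ * (η * μ) / n) * U := by
    rw [hω]; field_simp; ring
  have hSb : 0 ≤ (2 - 2 * (n * (η * μ))) * (ω * η ^ 2 * S) :=
    mul_nonneg (by linarith) (by positivity)
  have hUb : 0 ≤ (1 - 2 * (n * (η * μ))) * (δ * (η * μ) / n * U) :=
    mul_nonneg (by linarith) (by positivity)
  have hUe : (1 - 2 * (n * (η * μ))) * (δ * (η * μ) / n * U)
      = δ * (η * μ) / n * U - 2 * δ * (η * μ) ^ 2 * U := by field_simp
  have hHe : η * (μ * e + P + N / 2 - δ * μ / n * U / 2)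
      = η * μ * e + η * P + η * N / 2 - δ * (η * μ) / n * U / 2 := by ring
  have hUf : (4 * δ * (η * μ) - 2 * δ * (η * μ) / n) * U
      = 4 * δ * (η * μ) * U - 2 * (δ * (η * μ) / n * U) := by ring
  have e1 : 0 ≤ η * μ * e := by positivity
  have e2 : 0 ≤ η * P := by positivity
  have e3 : 0 ≤ η * N := by positivity
  rw [hL, hUf]
  rw [hUe] at hUb
  rw [hHe] at hHb
  linarith

/-- Scalar contraction estimate for the Lyapunov function used for a large shift cost. -/
theorem contraction_of_large_shift_cost {n η μ δ K e A S T P N H r : ℝ} (hn : 1 ≤ n) (hη : 0 < η)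
    (hμ : 0 < μ) (hδ : δ ≤ 1 / 8) (hK : 2 ≤ K) (he : 0 ≤ e) (hS : 0 ≤ S)
    (hT : 0 ≤ T) (hN : 0 ≤ N) (hstep : 12 * (η * μ) * K = 1)
    (hr1 : 2 * n * r ≤ 1) (hr2 : 4 * r ≤ η * μ)
    (hH : μ * e + P - N / 2 - δ * μ * e / 2 ≤ H)
    (hNT : N ≤ δ * μ / n * T)
    (hA : A ≤ 2 * (μ * K) * (2 * P + μ / 2 * e) + 8 * (δ * μ * N)) :
    e - 2 * η * H + η ^ 2 * (2 * A + 2 * S) + 4 * n * η ^ 2 * ((1 - 1 / n) * S + A / n)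
        + η * μ / 2 * ((1 - 1 / n) * T + e)
      ≤ (1 - r) * (e + 4 * n * η ^ 2 * S + η * μ / 2 * T) := by
  have hγ : 0 < η * μ := mul_pos hη hμ
  have hn0 : 0 < n := by linarith
  have b3 : 24 * (η * μ) ≤ 1 := by nlinarith
  -- With `12ημK = 1` the Bregman part of the noise is exactly `2ηP`, which the gain `2ηH` cancels
  -- with nothing left over.
  have hAb : 6 * η ^ 2 * A ≤ η * (2 * P + μ * e / 2 + N / 4) := by
    have h2 : 6 * η ^ 2 * A
        ≤ 6 * η ^ 2 * (2 * (μ * K) * (2 * P + μ / 2 * e) + 8 * (δ * μ * N)) :=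
      mul_le_mul_of_nonneg_left hA (by positivity)
    have h3 : 6 * η ^ 2 * (2 * (μ * K) * (2 * P + μ / 2 * e) + 8 * (δ * μ * N))
        = 12 * (η * μ) * K * (η * (2 * P + μ * e / 2)) + 48 * ((η * μ) * δ) * (η * N) := by ring
    have h4 : 48 * ((η * μ) * δ) * (η * N) ≤ 1 / 4 * (η * N) := by
      refine mul_le_mul_of_nonneg_right ?_ (by positivity)
      nlinarith
    rw [h3, hstep] at h2
    linarith
  have hHb := mul_le_mul_of_nonneg_left hH hη.le
  have hL : e - 2 * η * H + η ^ 2 * (2 * A + 2 * S)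
        + 4 * n * η ^ 2 * ((1 - 1 / n) * S + A / n) + η * μ / 2 * ((1 - 1 / n) * T + e)
      = e - 2 * (η * H) + 6 * η ^ 2 * A + (4 * n - 2) * η ^ 2 * S
        + η * μ / 2 * T - (η * μ / n * T) / 2 + η * μ * e / 2 := by
    field_simp; ring
  have hSb : 0 ≤ (1 - 2 * n * r) * (2 * η ^ 2 * S) :=
    mul_nonneg (by linarith) (by positivity)
  have hTb : 0 ≤ (1 - 2 * n * r) * (η * μ / n * T / 4) :=
    mul_nonneg (by linarith) (by positivity)
  have hTe : (1 - 2 * n * r) * (η * μ / n * T / 4) = η * μ / n * T / 4 - η * μ / 2 * r * T := by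
    field_simp
    ring
  -- Here `δ ≤ 1/8` enters: the weight error has no favourable term of its own and must be paid by
  -- the contraction of `T`.
  have hNb : η * N ≤ η * μ / n * T / 8 := by
    have h1 : η * (δ * μ / n * T) = δ * (η * μ / n * T) := by ring
    have h2 : δ * (η * μ / n * T) ≤ 1 / 8 * (η * μ / n * T) :=
      mul_le_mul_of_nonneg_right hδ (by positivity)
    have h3 := mul_le_mul_of_nonneg_left hNT hη.le
    linarith
  have hδe : δ * (η * μ * e) ≤ 1 / 8 * (η * μ * e) :=
    mul_le_mul_of_nonneg_right hδ (by positivity)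
  have hre : 4 * r * e ≤ η * μ * e := mul_le_mul_of_nonneg_right hr2 he
  have hHe : η * (μ * e + P - N / 2 - δ * μ * e / 2)
      = η * μ * e + η * P - η * N / 2 - δ * (η * μ * e) / 2 := by ring
  have e1 : 0 ≤ η * μ * e := by positivity
  have e4 : 0 ≤ η * μ / n * T := by positivity
  rw [hL]
  rw [hTe] at hTb
  rw [hHe] at hHb
  linarith

end ScalarBounds

/-- Standing assumptions on the losses, the spectrum, the divergence and the parameters. -/
structure IsProspectProblem {n d : ℕ} (ℓ : Fin n → EuclideanSpace ℝ (Fin d) → ℝ) (σ : Fin n → ℝ)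
    (f : ℝ → ℝ) (G L : ℝ≥0) (μ ν α : ℝ) : Prop where
  mu_pos : 0 < μ
  nu_pos : 0 < ν
  alpha_pos : 0 < α
  convex : ∀ k, ConvexOn ℝ Set.univ (ℓ k)
  lipschitz : ∀ k, LipschitzWith G (ℓ k)
  differentiable : ∀ k, Differentiable ℝ (ℓ k)
  smooth : ∀ k, LipschitzWith L (gradient (ℓ k))
  spectrum : IsSpectrum σ
  generator : IsDivergenceGenerator f
  strongConvex : StrongConvexOn (Set.Icc 0 (n : ℝ)) α f

/-! ### Convergence from a stationary point, under the standing assumptions. -/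

namespace IsProspectProblem

variable {n d : ℕ} [NeZero n] {ℓ : Fin n → EuclideanSpace ℝ (Fin d) → ℝ} {σ : Fin n → ℝ}
  {f : ℝ → ℝ} {G L : ℝ≥0} {μ ν α η : ℝ} {u : EuclideanSpace ℝ (Fin d)}

theorem natCast_pos : (0 : ℝ) < n := Nat.cast_pos.2 (NeZero.pos n)

theorem one_le_natCast : (1 : ℝ) ≤ n := Nat.one_le_cast.2 (NeZero.pos n)

theorem modulus_pos (h : IsProspectProblem ℓ σ f G L μ ν α) : 0 < n * α * ν :=
  mul_pos (mul_pos natCast_pos h.alpha_pos) h.nu_pos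

theorem isDualMaximizer (h : IsProspectProblem ℓ σ f G L μ ν α) (l : Fin n → ℝ) :
    IsDualMaximizer σ f ν l (qOpt σ f ν l) :=
  isDualMaximizer_qOpt h.spectrum h.generator l

/-- At a minimizer the mean direction vanishes, and with weights computed at that same point the
coupling is nonnegative, so the saddle-point inequality forces `μ‖w - u‖² ≤ 0`. -/
theorem eq_of_isMinOn (h : IsProspectProblem ℓ σ f G L μ ν α)
    (hu : ∑ k, qOpt σ f ν (fun i => ℓ i u) k • gradReg ℓ μ k u = 0)
    {w : EuclideanSpace ℝ (Fin d)} (hw : IsMinOn (objective ℓ σ f ν μ) Set.univ w) : w = u := by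
  have hw0 := sum_qOpt_smul_gradient_eq_zero h.nu_pos h.alpha_pos h.lipschitz h.differentiable
    h.spectrum h.generator h.strongConvex hw
  have hp := h.isDualMaximizer fun i => ℓ i u
  have hq := h.isDualMaximizer fun i => ℓ i w
  obtain ⟨hp0, -, hp1⟩ := permutahedron_bounds h.spectrum hp.1
  obtain ⟨hq0, -, hq1⟩ := permutahedron_bounds h.spectrum hq.1
  have h1 := le_inner_sum_smul_gradReg h.convex h.differentiable hp0 hp1 hq1 hu w
  rw [hw0, inner_zero_left] at h1
  have h2 := hq.monotone h.spectrum h.nu_pos.le h.strongConvex hp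
  have h3 : 0 ≤ n * α * ν * ∑ i, (qOpt σ f ν (fun i => ℓ i w) i
      - qOpt σ f ν (fun i => ℓ i u) i) ^ 2 :=
    mul_nonneg h.modulus_pos.le (Finset.sum_nonneg fun i _ => sq_nonneg _)
  have h4 : 0 ≤ ∑ k, qOpt σ f ν (fun i => ℓ i w) k * bregman ℓ k u w :=
    Finset.sum_nonneg fun k _ =>
      mul_nonneg (hq0 k) (bregman_nonneg h.convex h.differentiable k u w)
  have h5 : μ * ‖w - u‖ ^ 2 ≤ 0 := by linarith
  have h6 : ‖w - u‖ ^ 2 = 0 :=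
    le_antisymm (nonpos_of_mul_nonpos_right h5 h.mu_pos) (sq_nonneg _)
  exact sub_eq_zero.1 (norm_eq_zero.1 (pow_eq_zero_iff two_ne_zero |>.1 h6))

/-- Cross terms between weights and losses. -/
theorem abs_sum_weights_mul_losses_le (h : IsProspectProblem ℓ σ f G L μ ν α) (c : Fin n → ℝ)
    (x y : Fin n → EuclideanSpace ℝ (Fin d)) :
    |∑ k, c k * (ℓ k (x k) - ℓ k (y k))|
      ≤ n * α * ν * ∑ k, c k ^ 2 / 2
        + n * G ^ 2 / (μ * (n * α * ν)) * μ / n * (∑ k, ‖x k - y k‖ ^ 2) / 2 := by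
  have hm := h.modulus_pos
  have hn : (0 : ℝ) < n := natCast_pos
  have hμ := h.mu_pos
  -- The parameter `nαν` makes the weight term exactly half of the strong monotonicity bound.
  have h1 := abs_sum_mul_le_young Finset.univ c (fun k => ℓ k (x k) - ℓ k (y k)) hm
  have h2 : ∑ k, (ℓ k (x k) - ℓ k (y k)) ^ 2 ≤ G ^ 2 * ∑ k, ‖x k - y k‖ ^ 2 := by
    rw [Finset.mul_sum]
    refine Finset.sum_le_sum fun k _ => ?_
    rw [← mul_pow, ← sq_abs]
    exact pow_le_pow_left₀ (abs_nonneg _) ((h.lipschitz k).norm_sub_le _ _) 2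
  have h3 := mul_le_mul_of_nonneg_left h2 (by positivity : 0 ≤ (2 * (n * α * ν))⁻¹)
  have h4 : (2 * (n * α * ν))⁻¹ * (G ^ 2 * ∑ k, ‖x k - y k‖ ^ 2)
      = n * G ^ 2 / (μ * (n * α * ν)) * μ / n * (∑ k, ‖x k - y k‖ ^ 2) / 2 := by
    have := h.alpha_pos
    have := h.nu_pos
    field_simp
  rw [← Finset.sum_div]
  linarith

theorem norm_gradReg_le (h : IsProspectProblem ℓ σ f G L μ ν α)
    (hu : ∑ k, qOpt σ f ν (fun i => ℓ i u) k • gradReg ℓ μ k u = 0) (k : Fin n) :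
    ‖gradReg ℓ μ k u‖ ≤ 2 * G := by
  obtain ⟨hp0, -, hp1⟩ := permutahedron_bounds h.spectrum (h.isDualMaximizer fun i => ℓ i u).1
  exact norm_gradReg_le_of_stationary h.lipschitz h.differentiable hp0 hp1 hu k

/-- The gradient table error for the current weights, in terms of the condition numbers. -/
theorem gradTableError_current_le (h : IsProspectProblem ℓ σ f G L μ ν α)
    (hu : ∑ k, qOpt σ f ν (fun i => ℓ i u) k • gradReg ℓ μ k u = 0) (s : ProspectState n d) :
    gradTableError ℓ μ (qOpt σ f ν fun i => ℓ i u) u (s.q ℓ σ f ν) (fun _ => s.w)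
      ≤ 2 * (μ * (n * σ ⊤ * (1 + (1 + L / μ))))
          * (2 * ∑ k, s.q ℓ σ f ν k * bregman ℓ k u s.w + μ / 2 * ‖s.w - u‖ ^ 2)
        + 8 * (n * G ^ 2 / (μ * (n * α * ν)) * μ
          * (n * α * ν * ∑ k, (s.q ℓ σ f ν k - qOpt σ f ν (fun i => ℓ i u) k) ^ 2)) := by
  have hμ := h.mu_pos
  have hm := h.modulus_pos
  obtain ⟨hq0, hqs, hq1⟩ := permutahedron_bounds h.spectrum
    (h.isDualMaximizer fun k => ℓ k (s.ζ k)).1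
  refine (gradTableError_le_bregman hμ h.convex h.differentiable h.smooth (h.spectrum.nonneg ⊤) hq0
    hqs hq1 (h.norm_gradReg_le hu)).trans (le_of_eq ?_)
  unfold ProspectState.q
  congr 1
  · field_simp
    ring
  · have := h.alpha_pos
    have := h.nu_pos
    field_simp

theorem gradTableError_init_le (h : IsProspectProblem ℓ σ f G L μ ν α)
    (hu : ∑ k, qOpt σ f ν (fun i => ℓ i u) k • gradReg ℓ μ k u = 0)
    (w₀ : EuclideanSpace ℝ (Fin d)) :
    gradTableError ℓ μ (qOpt σ f ν fun i => ℓ i u) u (qOpt σ f ν fun k => ℓ k w₀) (fun _ => w₀)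
      ≤ (2 * (n * σ ⊤) * (μ * (1 + L / μ)) ^ 2
          + 8 * (n * G ^ 2 / (μ * (n * α * ν)) * μ) ^ 2) * ‖w₀ - u‖ ^ 2 := by
  have hμ := h.mu_pos
  have hm := h.modulus_pos
  have hq := h.isDualMaximizer fun k => ℓ k w₀
  obtain ⟨hq0, hqs, hq1⟩ := permutahedron_bounds h.spectrum hq.1
  refine (gradTableError_le_sq_dist hμ h.differentiable h.smooth (h.spectrum.nonneg ⊤) hq0
    hqs hq1 (h.norm_gradReg_le hu)).trans ?_
  have h1 := IsDualMaximizer.sq_dist_le (x := fun _ => w₀) (y := fun _ => u) h.spectrum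
    h.nu_pos.le h.alpha_pos.le h.strongConvex h.lipschitz hq (h.isDualMaximizer fun k => ℓ k u)
  simp only [Finset.sum_const, Finset.card_univ, Fintype.card_fin, nsmul_eq_mul] at h1
  have h2 : n * G ^ 2 * ∑ k, (qOpt σ f ν (fun k => ℓ k w₀) k - qOpt σ f ν (fun i => ℓ i u) k) ^ 2
      ≤ (n * G ^ 2 / (μ * (n * α * ν)) * μ) ^ 2 * ‖w₀ - u‖ ^ 2 := by
    have h3 := mul_le_mul_of_nonneg_left h1
      (by positivity : 0 ≤ (n : ℝ) * G ^ 2 / (n * α * ν) ^ 2)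
    refine le_trans (le_of_eq ?_) (h3.trans (le_of_eq ?_))
    · rw [← mul_assoc, div_mul_cancel₀ _ (pow_ne_zero 2 hm.ne')]
    · field_simp
  have h4 : μ * (1 + L / μ) = L + μ := by field_simp; ring
  rw [h4]
  linarith

theorem two_le_mul (h : IsProspectProblem ℓ σ f G L μ ν α) :
    2 ≤ n * σ ⊤ * (1 + (1 + L / μ)) := by
  have h1 := h.spectrum.one_le_mul_top
  have h2 : 0 ≤ (L : ℝ) / μ := div_nonneg L.2 h.mu_pos.le
  nlinarith

theorem sum_mul_bregman_nonneg (h : IsProspectProblem ℓ σ f G L μ ν α) (s : ProspectState n d) :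
    0 ≤ ∑ k, s.q ℓ σ f ν k * bregman ℓ k u s.w := by
  obtain ⟨hq0, -, -⟩ := permutahedron_bounds h.spectrum
    (h.isDualMaximizer fun k => ℓ k (s.ζ k)).1
  exact Finset.sum_nonneg fun k _ =>
    mul_nonneg (hq0 k) (bregman_nonneg h.convex h.differentiable k u s.w)

theorem le_inner_direction (h : IsProspectProblem ℓ σ f G L μ ν α)
    (hu : ∑ k, qOpt σ f ν (fun i => ℓ i u) k • gradReg ℓ μ k u = 0) (s : ProspectState n d) :
    ∑ k, (s.q ℓ σ f ν k - qOpt σ f ν (fun i => ℓ i u) k) * (ℓ k s.w - ℓ k u)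
        + μ * ‖s.w - u‖ ^ 2 + ∑ k, s.q ℓ σ f ν k * bregman ℓ k u s.w
      ≤ inner ℝ (∑ k, s.q ℓ σ f ν k • gradReg ℓ μ k s.w) (s.w - u) := by
  obtain ⟨hp0, -, hp1⟩ := permutahedron_bounds h.spectrum (h.isDualMaximizer fun i => ℓ i u).1
  obtain ⟨-, -, hq1⟩ := permutahedron_bounds h.spectrum
    (h.isDualMaximizer fun k => ℓ k (s.ζ k)).1
  exact le_inner_sum_smul_gradReg h.convex h.differentiable hp0 hp1 hq1 hu s.w

variable {Ω : Type*} [MeasurableSpace Ω] {P : Measure Ω} [IsProbabilityMeasure P]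
  {i j : ℕ → Ω → Fin n}

/-- Linear convergence with a small step size, for any shift cost. -/
theorem expectedSqDist_le_of_small_step (h : IsProspectProblem ℓ σ f G L μ ν α)
    (hij : IsUniformSampling P i j)
    (hu : ∑ k, qOpt σ f ν (fun i => ℓ i u) k • gradReg ℓ μ k u = 0) (hη : 0 < η) {δ κ τ : ℝ}
    (hδ : δ = n * G ^ 2 / (μ * (n * α * ν))) (hκ : κ = 1 + L / μ)
    (hstep : 96 * (n * (η * μ)) * (8 * δ + n * σ ⊤ * (1 + κ)) ≤ 1) (hτ : τ⁻¹ ≤ η * μ / 2)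
    (w₀ : EuclideanSpace ℝ (Fin d)) (t : ℕ) :
    expectedSqDist P i j ℓ σ f ν μ η w₀ u t
      ≤ (1 + 8 * (n * (η * μ)) ^ 2 * (2 * (n * σ ⊤) * κ ^ 2 + 8 * δ ^ 2))
        * Real.exp (-(t : ℝ) / τ) * ‖w₀ - u‖ ^ 2 := by
  have hμ := h.mu_pos
  have hm := h.modulus_pos
  have hn1 : (1 : ℝ) ≤ n := one_le_natCast
  have hγ : 0 < η * μ := mul_pos hη hμ
  have hδ0 : 0 ≤ δ := by rw [hδ]; positivity
  have hK : 2 ≤ n * σ ⊤ * (1 + κ) := hκ ▸ h.two_le_mul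
  set p := qOpt σ f ν (fun i => ℓ i u)
  set ω : ℝ := 1 + (1 + 2 * n) * (n * (4 * δ * (η * μ))) with hω
  have hω0 : 0 ≤ ω := by positivity
  -- The bound on `ω` does not involve the state, so it is read off at all-zero values; it is needed
  -- for the initial Lyapunov value.
  have hω2 : ω ≤ 2 * n := (contraction_of_small_step (e := 0) (A := 0) (S := 0) (U := 0) (P := 0)
    (N := 0) (H := 0) hn1 hη hμ hδ0 hK le_rfl le_rfl le_rfl le_rfl le_rfl le_rfl hω hstep
    (by simp) (by simp)).1
  refine expectedSqDist_le_of_lyapunov hij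
    (lyapunov ℓ μ p u (4 * n * ω * η ^ 2) 0 (4 * δ * (η * μ))) (r := η * μ / 2)
    (sq_norm_sub_le_lyapunov (by positivity) le_rfl (by positivity)) ?_ hτ (fun s => ?_) ?_ t
  · have h1 : n * (η * μ) * 2 ≤ n * (η * μ) * (8 * δ + n * σ ⊤ * (1 + κ)) :=
      mul_le_mul_of_nonneg_left (by linarith) (by positivity)
    have h2 : η * μ ≤ n * (η * μ) := le_mul_of_one_le_left hγ.le hn1
    linarith
  · refine (sum_sum_lyapunov_step_le (NeZero.pos n) hu (by positivity) s rfl rfl rfl rfl rfl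
      rfl).trans (mul_le_mul_of_nonneg_left ?_ (by positivity))
    have hmono := (h.isDualMaximizer fun k => ℓ k (s.ζ k)).monotone h.spectrum h.nu_pos.le
      h.strongConvex (h.isDualMaximizer fun i => ℓ i u)
    have hcross := (abs_le.1 (h.abs_sum_weights_mul_losses_le
      (fun k => s.q ℓ σ f ν k - p k) (fun _ => s.w) s.ζ)).1
    have hinner := h.le_inner_direction hu s
    have hcur := h.gradTableError_current_le hu s
    rw [← hδ, ← Finset.sum_div] at hcross
    rw [← hδ, ← hκ] at hcur
    -- Split at the stale losses, from which `q` was computed: `hmono` bounds the first sum below by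
    -- `N`, `hcross` the second by `-N/2` minus the staleness.
    have hsplit : ∑ k, (s.q ℓ σ f ν k - p k) * (ℓ k s.w - ℓ k u)
        = ∑ k, (s.q ℓ σ f ν k - p k) * (ℓ k (s.ζ k) - ℓ k u)
          + ∑ k, (s.q ℓ σ f ν k - p k) * (ℓ k s.w - ℓ k (s.ζ k)) := by
      rw [← Finset.sum_add_distrib]
      exact Finset.sum_congr rfl fun k _ => by ring
    have hfin := (contraction_of_small_step hn1 hη hμ hδ0 hK (sq_nonneg ‖s.w - u‖)
      (gradTableError_nonneg p u _ _) (gradTableError_nonneg (ℓ := ℓ) (μ := μ) p u s.ρ s.z)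
      (Finset.sum_nonneg (s := Finset.univ) fun k _ => sq_nonneg ‖s.w - s.ζ k‖) (h.sum_mul_bregman_nonneg s)
      (mul_nonneg hm.le (Finset.sum_nonneg fun k _ => sq_nonneg (s.q ℓ σ f ν k - p k))) hω hstep
      (H := inner ℝ (∑ k, s.q ℓ σ f ν k • gradReg ℓ μ k s.w) (s.w - u)) ?_ hcur).2
    · unfold lyapunov
      linarith
    · change n * α * ν * ∑ k, (s.q ℓ σ f ν k - p k) ^ 2
        ≤ ∑ k, (s.q ℓ σ f ν k - p k) * (ℓ k (s.ζ k) - ℓ k u) at hmono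
      linarith
  · have h0 := h.gradTableError_init_le hu w₀
    rw [← hδ, ← hκ] at h0
    have hS0 : 0 ≤ gradTableError ℓ μ p u (qOpt σ f ν fun k => ℓ k w₀) (fun _ => w₀) :=
      gradTableError_nonneg _ _ _ _
    have h1 : 4 * n * ω * η ^ 2 ≤ 8 * (n * η) ^ 2 := by
      have : 0 ≤ n * η ^ 2 := by positivity
      nlinarith
    have h2 := mul_le_mul h1 h0 hS0 (by positivity)
    simp only [lyapunov, prospectInit, sub_self, norm_zero, ne_eq, OfNat.ofNat_ne_zero,
      not_false_eq_true, zero_pow, Finset.sum_const_zero, mul_zero, zero_mul, add_zero]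
    linarith

/-- Linear convergence for a large shift cost. -/
theorem expectedSqDist_le_of_large_shift_cost (h : IsProspectProblem ℓ σ f G L μ ν α)
    (hij : IsUniformSampling P i j)
    (hu : ∑ k, qOpt σ f ν (fun i => ℓ i u) k • gradReg ℓ μ k u = 0) (hη : 0 < η) {δ κ r τ : ℝ}
    (hδ : δ = n * G ^ 2 / (μ * (n * α * ν))) (hκ : κ = 1 + L / μ) (hδ8 : δ ≤ 1 / 8)
    (hstep : 12 * (η * μ) * (n * σ ⊤ * (1 + κ)) = 1) (hr1 : 2 * n * r ≤ 1)
    (hr2 : 4 * r ≤ η * μ) (hτ : τ⁻¹ ≤ r) (w₀ : EuclideanSpace ℝ (Fin d)) (t : ℕ) :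
    expectedSqDist P i j ℓ σ f ν μ η w₀ u t
      ≤ (1 + 4 * n * (η * μ) ^ 2 * (2 * (n * σ ⊤) * κ ^ 2 + 8 * δ ^ 2) + n * (η * μ) / 2)
        * Real.exp (-(t : ℝ) / τ) * ‖w₀ - u‖ ^ 2 := by
  have hμ := h.mu_pos
  have hm := h.modulus_pos
  have hn1 : (1 : ℝ) ≤ n := one_le_natCast
  have hγ : 0 < η * μ := mul_pos hη hμ
  have hK : 2 ≤ n * σ ⊤ * (1 + κ) := hκ ▸ h.two_le_mul
  set p := qOpt σ f ν (fun i => ℓ i u)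
  refine expectedSqDist_le_of_lyapunov hij
    (lyapunov ℓ μ p u (4 * n * η ^ 2) (η * μ / 2) 0) (r := r)
    (sq_norm_sub_le_lyapunov (by positivity) (by positivity) le_rfl) ?_ hτ (fun s => ?_) ?_ t
  · nlinarith
  · refine (sum_sum_lyapunov_step_le (NeZero.pos n) hu le_rfl s rfl rfl rfl rfl rfl
      rfl).trans (mul_le_mul_of_nonneg_left ?_ (by positivity))
    have hcross := (abs_le.1 (h.abs_sum_weights_mul_losses_le
      (fun k => s.q ℓ σ f ν k - p k) (fun _ => s.w) (fun _ => u))).1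
    have hinner := h.le_inner_direction hu s
    have hcur := h.gradTableError_current_le hu s
    have hdist := (h.isDualMaximizer fun k => ℓ k (s.ζ k)).sq_dist_le (y := fun _ => u) h.spectrum
      h.nu_pos.le h.alpha_pos.le h.strongConvex h.lipschitz (h.isDualMaximizer fun i => ℓ i u)
    rw [← hδ, ← Finset.sum_div] at hcross
    rw [← hδ, ← hκ] at hcur
    simp only [Finset.sum_const, Finset.card_univ, Fintype.card_fin, nsmul_eq_mul] at hcross
    have hce : δ * μ / n * (n * ‖s.w - u‖ ^ 2) = δ * μ * ‖s.w - u‖ ^ 2 := by field_simp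
    rw [hce] at hcross
    -- Lipschitz continuity of the weights turns their error into the distance of the loss-table
    -- points from `u`.
    have hNT : n * α * ν * ∑ k, (s.q ℓ σ f ν k - p k) ^ 2 ≤ δ * μ / n * ∑ k, ‖s.ζ k - u‖ ^ 2 := by
      have h1 := mul_le_mul_of_nonneg_left hdist (inv_nonneg.2 hm.le)
      refine le_trans (le_of_eq ?_) (h1.trans (le_of_eq ?_))
      · rw [pow_two (n * α * ν), mul_assoc (n * α * ν) (n * α * ν), inv_mul_cancel_left₀ hm.ne']
        rfl
      · rw [hδ]
        have := h.alpha_pos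
        have := h.nu_pos
        field_simp
    have hfin := contraction_of_large_shift_cost hn1 hη hμ hδ8 hK (sq_nonneg ‖s.w - u‖)
      (gradTableError_nonneg (ℓ := ℓ) (μ := μ) p u s.ρ s.z)
      (Finset.sum_nonneg (s := Finset.univ) fun k _ => sq_nonneg ‖s.ζ k - u‖)
      (mul_nonneg hm.le (Finset.sum_nonneg fun k _ => sq_nonneg (s.q ℓ σ f ν k - p k))) hstep
      hr1 hr2 (H := inner ℝ (∑ k, s.q ℓ σ f ν k • gradReg ℓ μ k s.w) (s.w - u)) ?_ hNT hcur
    · unfold lyapunov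
      linarith
    · linarith
  · have h0 := h.gradTableError_init_le hu w₀
    rw [← hδ, ← hκ] at h0
    have h2 := mul_le_mul_of_nonneg_left h0 (by positivity : 0 ≤ 4 * n * η ^ 2)
    simp only [lyapunov, prospectInit, Finset.sum_const, Finset.card_univ, Fintype.card_fin,
      nsmul_eq_mul, zero_mul, add_zero]
    linarith

end IsProspectProblem

/-! ### Initial values of the Lyapunov functions, and assembly. -/

theorem prefactor_large_le {n s γ κ δ : ℝ} (hn : 1 ≤ n) (hs : 0 < s) (hns : 1 ≤ n * s)
    (hκ : 1 ≤ κ) (hγ : 0 < γ) (hδ0 : 0 ≤ δ) (hδ : δ ≤ 1 / 8)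
    (hstep : 12 * γ * (n * s * (1 + κ)) = 1) :
    1 + 4 * n * γ ^ 2 * (2 * (n * s) * κ ^ 2 + 8 * δ ^ 2) + n * γ / 2
      ≤ 1 + s⁻¹ + (s ^ 2)⁻¹ := by
  have hn0 : 0 < n := by linarith
  have hκs : 12 * (γ * κ * (n * s)) ≤ 1 := by nlinarith [mul_pos hγ (mul_pos hn0 hs)]
  -- All excess terms are controlled by `γnκ`, so `s⁻¹` alone absorbs them.
  have h1 : γ * n * κ ≤ s⁻¹ / 12 := by
    rw [inv_eq_one_div, div_div, le_div_iff₀ (by positivity)]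
    linarith
  have h2 : γ * n ≤ s⁻¹ / 12 := by
    refine le_trans ?_ h1
    exact le_mul_of_one_le_right (by positivity) hκ
  have h3 : γ ≤ 1 / 12 := by
    have : γ * 1 ≤ γ * κ * (n * s) := by
      rw [mul_assoc]
      exact mul_le_mul_of_nonneg_left (one_le_mul_of_one_le_of_one_le hκ hns) hγ.le
    linarith
  have h4 : 4 * n * γ ^ 2 * (2 * (n * s) * κ ^ 2) ≤ 8 / 12 * (s⁻¹ / 12) := by
    have e : 4 * n * γ ^ 2 * (2 * (n * s) * κ ^ 2)
        = 8 / 12 * ((12 * (γ * κ * (n * s))) * (γ * n * κ)) := by ring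
    rw [e]
    have : (12 * (γ * κ * (n * s))) * (γ * n * κ) ≤ 1 * (γ * n * κ) :=
      mul_le_mul_of_nonneg_right hκs (by positivity)
    linarith
  have h5 : 4 * n * γ ^ 2 * (8 * δ ^ 2) ≤ γ * n := by
    have e : 4 * n * γ ^ 2 * (8 * δ ^ 2) = (γ * n) * (32 * (γ * δ ^ 2)) := by ring
    have : 32 * (γ * δ ^ 2) ≤ 1 := by nlinarith
    rw [e]
    exact mul_le_of_le_one_right (by positivity) this
  have hs0 : 0 ≤ s⁻¹ := by positivity
  have hs2 : 0 ≤ (s ^ 2)⁻¹ := by positivity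
  rw [mul_add]
  linarith

/-- Here `x = nημ`. The step condition bounds both `xδ` and `xκσ` by small constants, and `s ≤ 1`
gives `κ² ≤ κ²/s`. -/
theorem prefactor_small_le {s κσ x κ δ : ℝ} (hs : 0 < s) (hs1 : s ≤ 1) (hκσ : 1 ≤ κσ)
    (hκ : 1 ≤ κ) (hx : 0 < x) (hδ : 0 ≤ δ) (hstep : 96 * x * (8 * δ + κσ * (1 + κ)) ≤ 1) :
    1 + 8 * x ^ 2 * (2 * κσ * κ ^ 2 + 8 * δ ^ 2) ≤ 5 + 16 * δ + 6 * κ ^ 2 / s := by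
  have h0 : 0 ≤ x * δ := by positivity
  have h0' : 0 ≤ x * κσ * κ := by positivity
  have h1 : x * δ ≤ 1 / 768 := by nlinarith
  have h2 : x * κσ ≤ 1 / 96 := by nlinarith
  have h3 : x ≤ 1 / 96 := (le_mul_of_one_le_right hx.le hκσ).trans h2
  have h4 : (x * δ) ^ 2 ≤ x * δ * (1 / 768) := by nlinarith
  have h5 : x * (x * κσ) ≤ 1 / 96 * (1 / 96) := mul_le_mul h3 h2 (by positivity) (by norm_num)
  have h6 : κ ^ 2 ≤ κ ^ 2 / s := by
    rw [le_div_iff₀ hs]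
    exact mul_le_of_le_one_right (sq_nonneg κ) hs1
  have h7 : x * (x * κσ) * κ ^ 2 ≤ 1 / 96 * (1 / 96) * κ ^ 2 :=
    mul_le_mul_of_nonneg_right h5 (sq_nonneg κ)
  have e : 8 * x ^ 2 * (2 * κσ * κ ^ 2 + 8 * δ ^ 2)
      = 16 * (x * (x * κσ) * κ ^ 2) + 64 * (x * δ) ^ 2 := by ring
  have e2 : 6 * κ ^ 2 / s = 6 * (κ ^ 2 / s) := by ring
  have h8 : 0 ≤ κ ^ 2 := sq_nonneg κ
  rw [e, e2]
  linarith

theorem theorem1 {n d : ℕ} [NeZero n]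
    (ℓ : Fin n → EuclideanSpace ℝ (Fin d) → ℝ) (σ : Fin n → ℝ) (f : ℝ → ℝ)
    (G L : ℝ≥0) (μ ν α : ℝ) (hμ : 0 < μ) (hν : 0 < ν) (hα : 0 < α)
    (hconv : ∀ k, ConvexOn ℝ Set.univ (ℓ k))
    (hlip : ∀ k, LipschitzWith G (ℓ k))
    (hdiff : ∀ k, Differentiable ℝ (ℓ k))
    (hsmooth : ∀ k, LipschitzWith L (gradient (ℓ k)))
    (hσ : IsSpectrum σ)
    (hf : IsDivergenceGenerator f)
    (hfα : StrongConvexOn (Set.Icc 0 (n : ℝ)) α f)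
    {Ω : Type*} [MeasurableSpace Ω] (P : Measure Ω) [IsProbabilityMeasure P]
    (i j : ℕ → Ω → Fin n) (hij : IsUniformSampling P i j) :
    -- the largest entry of the spectrum and the condition numbers
    let σₙ : ℝ := σ ⊤
    let κ : ℝ := 1 + L / μ
    let κσ : ℝ := n * σₙ
    let δ : ℝ := n * (G : ℝ) ^ 2 / (μ * (n * α * ν))
    -- the dual weights are well defined
    (∀ l : Fin n → ℝ, ∃! q : Fin n → ℝ, IsDualMaximizer σ f ν l q) ∧
    -- the objective has a unique minimizer `wStar`, and
    ∃ wStar : EuclideanSpace ℝ (Fin d),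
      IsMinOn (objective ℓ σ f ν μ) Set.univ wStar ∧
      (∀ w, IsMinOn (objective ℓ σ f ν μ) Set.univ w → w = wStar) ∧
      -- for every shift cost, linear convergence for all small enough step sizes
      (∃ η₀ : ℝ, 0 < η₀ ∧ ∀ η : ℝ, 0 < η → η ≤ η₀ →
        ∃ C τ : ℝ, 0 < C ∧ 0 < τ ∧ ∀ (w₀ : EuclideanSpace ℝ (Fin d)) (t : ℕ),
          expectedSqDist P i j ℓ σ f ν μ η w₀ wStar t
            ≤ C * Real.exp (-(t : ℝ) / τ) * ‖w₀ - wStar‖ ^ 2) ∧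
      -- large shift cost
      (8 * (G : ℝ) ^ 2 / (μ * α) ≤ ν →
        let η : ℝ := 1 / (12 * μ * (1 + κ) * κσ)
        let τ : ℝ := 2 * max (n : ℝ) (24 * κσ * (κ + 1))
        ∀ (w₀ : EuclideanSpace ℝ (Fin d)) (t : ℕ),
          expectedSqDist P i j ℓ σ f ν μ η w₀ wStar t
            ≤ (1 + σₙ⁻¹ + (σₙ ^ 2)⁻¹) * Real.exp (-(t : ℝ) / τ) * ‖w₀ - wStar‖ ^ 2) ∧
      -- small shift cost
      (2 ≤ n → ν ≤ 8 * (G : ℝ) ^ 2 / (μ * α) →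
        let η : ℝ := 1 / (16 * n * μ) *
          min (1 / (6 * (8 * δ + (κ + 1) * κσ))) (1 / (4 * δ ^ 2 * max (2 * n * κ ^ 2) δ))
        let τ : ℝ := 32 * n *
          max (6 * (8 * δ + (κ + 1) * κσ)) (max (4 * δ ^ 2 * max (2 * n * κ ^ 2) δ) (1 / 16))
        ∀ (w₀ : EuclideanSpace ℝ (Fin d)) (t : ℕ),
          expectedSqDist P i j ℓ σ f ν μ η w₀ wStar t
            ≤ (5 + 16 * δ + 6 * κ ^ 2 / σₙ) * Real.exp (-(t : ℝ) / τ) * ‖w₀ - wStar‖ ^ 2) := by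
  intro σₙ κ κσ δ
  have h : IsProspectProblem ℓ σ f G L μ ν α :=
    ⟨hμ, hν, hα, hconv, hlip, hdiff, hsmooth, hσ, hf, hfα⟩
  have hn0 : (0 : ℝ) < n := IsProspectProblem.natCast_pos
  have hn1 : (1 : ℝ) ≤ n := IsProspectProblem.one_le_natCast
  have hκσ : 1 ≤ κσ := hσ.one_le_mul_top
  have hσ1 : σₙ ≤ 1 := hσ.top_le_one
  have hσ0 : 0 < σₙ := pos_of_mul_pos_right (zero_lt_one.trans_le hκσ) hn0.le
  have hκ : 1 ≤ κ := le_add_of_nonneg_right (div_nonneg L.2 hμ.le)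
  have hK : 2 ≤ κσ * (1 + κ) := h.two_le_mul
  have hδ0 : 0 ≤ δ := by positivity
  have hδν : δ * (μ * α * ν) = G ^ 2 := by
    simp only [δ]
    field_simp
  refine ⟨fun l => ⟨qOpt σ f ν l, h.isDualMaximizer l, fun q hq =>
    hq.eq hσ hν hα hfα (h.isDualMaximizer l)⟩, ?_⟩
  obtain ⟨u, hmin⟩ := exists_isMinOn_objective (ν := ν) hμ hlip hσ hf
  have hu := sum_qOpt_smul_gradient_eq_zero hν hα hlip hdiff hσ hf hfα hmin
  refine ⟨u, hmin, fun w hw => h.eq_of_isMinOn hu hw, ?_, ?_, ?_⟩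
  · refine ⟨1 / (96 * n * μ * (8 * δ + κσ * (1 + κ))), by positivity, fun η hη hη0 => ?_⟩
    rw [le_div_iff₀ (by positivity)] at hη0
    refine ⟨_, 2 / (η * μ), ?_, by positivity, fun w₀ t =>
      h.expectedSqDist_le_of_small_step hij hu hη rfl rfl ?_ ?_ w₀ t⟩
    · positivity
    · linarith
    · rw [inv_div]
  · intro hν8 η τ w₀ t
    have hη : 0 < η := by positivity
    have hδ8 : δ ≤ 1 / 8 := by
      rw [div_le_iff₀ (by positivity)] at hν8
      have : δ * (μ * α * ν) ≤ 1 / 8 * (μ * α * ν) := by rw [hδν]; linarith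
      exact le_of_mul_le_mul_right this (by positivity)
    have hημ : η * μ = 1 / (12 * (κσ * (1 + κ))) := by
      simp only [η]
      field_simp
    have hstep : 12 * (η * μ) * (κσ * (1 + κ)) = 1 := by
      rw [hημ]
      field_simp
    have hmax0 : 0 < max (n : ℝ) (24 * κσ * (κ + 1)) := lt_max_of_lt_left hn0
    refine (h.expectedSqDist_le_of_large_shift_cost hij hu hη rfl rfl hδ8 hstep (r := τ⁻¹)
      ?_ ?_ le_rfl w₀ t).trans ?_
    · rw [← div_eq_mul_inv, div_le_one (by positivity)]
      exact mul_le_mul_of_nonneg_left (le_max_left _ _) zero_le_two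
    · rw [← div_eq_mul_inv, hημ, div_le_div_iff₀ (by positivity) (by positivity)]
      have : 24 * κσ * (κ + 1) ≤ max (n : ℝ) (24 * κσ * (κ + 1)) := le_max_right _ _
      simp only [τ]
      linarith
    · refine mul_le_mul_of_nonneg_right (mul_le_mul_of_nonneg_right ?_ (Real.exp_pos _).le)
        (sq_nonneg _)
      exact prefactor_large_le hn1 hσ0 hκσ hκ (by positivity) hδ0 hδ8 hstep
  · intro _ hν8 η τ w₀ t
    -- If `δ` were `0` then `b = 0`, and `1 / 0 = 0` would make the step zero; the upper bound on
    -- `ν` rules this out by forcing `G > 0`.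
    have hδpos : 0 < δ := by
      rw [le_div_iff₀ (by positivity)] at hν8
      have hG : 0 < (G : ℝ) ^ 2 := by
        have : 0 < ν * (μ * α) := by positivity
        linarith
      rw [← hδν] at hG
      exact pos_of_mul_pos_left hG (by positivity)
    set a := 6 * (8 * δ + (κ + 1) * κσ) with ha
    set b := 4 * δ ^ 2 * max (2 * n * κ ^ 2) δ with hb
    have ha0 : 0 < a := by positivity
    have hb0 : 0 < b := mul_pos (by positivity) (lt_max_of_lt_right hδpos)
    have hmin_inv : min (1 / a) (1 / b) = 1 / max a b := by
      rcases le_total a b with hab | hab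
      · rw [max_eq_right hab, min_eq_right (one_div_le_one_div_of_le ha0 hab)]
      · rw [max_eq_left hab, min_eq_left (one_div_le_one_div_of_le hb0 hab)]
    have hM0 : 0 < max a b := lt_max_of_lt_left ha0
    have hη_eq : η = 1 / (16 * n * μ) * (1 / max a b) := by rw [← hmin_inv]
    have hη : 0 < η := by rw [hη_eq]; positivity
    have hγ : n * (η * μ) = 1 / (16 * max a b) := by
      rw [hη_eq]
      field_simp
    have hstep : 96 * (n * (η * μ)) * (8 * δ + κσ * (1 + κ)) ≤ 1 := by
      have e : 96 * (n * (η * μ)) * (8 * δ + κσ * (1 + κ)) = a / max a b := by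
        rw [hγ, ha]
        field_simp
        ring
      rw [e, div_le_one hM0]
      exact le_max_left _ _
    refine (h.expectedSqDist_le_of_small_step hij hu hη rfl rfl hstep (τ := τ) ?_ w₀ t).trans ?_
    · have hτ : 32 * n * max a b ≤ τ :=
        mul_le_mul_of_nonneg_left (max_le_max le_rfl (le_max_left _ _)) (by positivity)
      have e : η * μ / 2 = (32 * n * max a b)⁻¹ := by
        rw [hη_eq]
        field_simp
        norm_num
      rw [e]
      exact inv_anti₀ (by positivity) hτ
    · refine mul_le_mul_of_nonneg_right (mul_le_mul_of_nonneg_right ?_ (Real.exp_pos _).le)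
        (sq_nonneg _)
      exact prefactor_small_le hσ0 hσ1 hκσ hκ (by positivity) hδ0 hstep
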